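/- **Conventions.** Powers are principal, and $1/\Gamma$ is read as $0$ at the poles of $\Gamma$. For $\varphi$ analytic in the disk $|p|<r$ with $\varphi(p)=\sum_{n\ge 0}\varphi_n p^n$, for $\alpha\in\mathbb C\setminus\{0,-1,-2,\dots\}$ and a ray $e^{i\theta}\mathbb R_+$, the Hadamard finite part of $\int_{e^{i\theta}\mathbb R_+}p^{\alpha-1}\varphi(p)\,dp$ is $$\sum_{n\ge 0}\frac{\varphi_n}{n+\alpha}\,x^{n+\alpha}+\int_{x}^{e^{i\theta}\infty}p^{\alpha-1}\varphi(p)\,dp,\qquad x=Re^{i\theta},\ 0<R<r$$ (it does not depend on $R$, and the second integral is taken along the ray). The Écalle medianization is $$M\int_0^\infty g(p)\,dp=\tfrac12\int_{e^{i0-}\mathbb R_+}g(p)\,dp+\tfrac12\int_{e^{i0+}\mathbb R_+}g(p)\,dp,$$ the average of the integrals along the rays from $0$ of small negative and of small positive angle (each of the two is independent of the angle once this is small enough). **Theorem.** There are functions $U,V:\mathbb C\times\mathbb C\to\mathbb C$, entire in $(a,z)$ jointly, such that for every $a\in\mathbb C$ the functions $U(a,\cdot)$ and $V(a,\cdot)$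 are two linearly independent solutions of the Weber equation $w''(z)-\left(\tfrac{z^2}{4}+a\right)w(z)=0$. They are the classical parabolic cylinder functions, that is, $$U(a,0)=\frac{\sqrt\pi}{2^{a/2+1/4}\,\Gamma(\frac34+\frac a2)},\qquad U'(a,0)=-\frac{\sqrt\pi}{2^{a/2-1/4}\,\Gamma(\frac14+\frac a2)},$$ $$V(a,0)=\frac{\pi\,2^{a/2+1/4}}{\Gamma(\frac34-\frac a2)^2\,\Gamma(\frac14+\frac a2)},\qquad V'(a,0)=\frac{\pi\,2^{a/2+3/4}}{\Gamma(\frac14-\frac a2)^2\,\Gamma(\frac34+\frac a2)},$$ and they have the following representations: for all $a\in\mathbb C$ and all $z\neq 0$ with $|\arg z|<\frac\pi4$, $$U(a,z)=u_-(a,z^2),\qquad V(a,z)=\sqrt{\tfrac2\pi}\;u_+(a,z^2),$$ where, for $\operatorname{Re}y>0$, $$u_-(a,y)=\frac{e^{-y/4}}{\Gamma(\frac14+\frac a2)}\int_0^\infty e^{-py}\,p^{\frac a2-\frac34}(1+2p)^{-\frac a2-\frac34}\,dp\qquad\left(\tfrac14+\tfrac a2\ne 0,-1,-2,\dots\right),$$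 $$u_+(a,y)=\frac{e^{y/4}}{\Gamma(\frac14-\frac a2)}\;M\!\int_0^\infty e^{-py}\,p^{-\frac34-\frac a2}(1-2p)^{-\frac34+\frac a2}\,dp\qquad\left(\tfrac14-\tfrac a2\ne 0,-1,-2,\dots\right).$$ The integrals are Lebesgue integrals if $\operatorname{Re}a>-\frac12$, respectively $\operatorname{Re}a<\frac12$, and Hadamard finite parts otherwise. The singularities of these formulas at $\frac14+\frac a2\in\{0,-1,-2,\dots\}$, respectively $\frac14-\frac a2\in\{0,-1,-2,\dots\}$, are removable: for every $y$ with $\operatorname{Re}y>0$ the functions $a\mapsto u_\pm(a,y)$, extended to these values of $a$ by continuity, are entire. Moreover, for all $a,z\in\mathbb C$, $$U(a,-z)=-\sin(\pi a)\,U(a,z)+\frac{\pi}{\Gamma(\frac12+a)}\,V(a,z),$$ $$V(a,-z)=\frac{\cos(\pi a)}{\Gamma(\frac12-a)}\,U(a,z)+\sin(\pi a)\,V(a,z).$$ -/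

import Mathlib

open Filter Topology

/-- The integrand of `∫ p ^ (α - 1) * φ p dp` along the ray `p = t * exp (i θ)`, `t > 0`,
in the parameter `t` (principal branch of the power; used for `|θ| < π`). -/
noncomputable def rayIntegrand (θ : ℝ) (α : ℂ) (φ : ℂ → ℂ) (t : ℝ) : ℂ :=
  ((t : ℂ) * Complex.exp (θ * Complex.I)) ^ (α - 1) *
    φ ((t : ℂ) * Complex.exp (θ * Complex.I)) * Complex.exp (θ * Complex.I)

/-- `J` is the (absolutely convergent) Lebesgue integral of `p ^ (α - 1) * φ p` along the ray
from `0` to infinity with direction `exp (i θ)`. -/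
def HasRayIntegral (θ : ℝ) (α : ℂ) (φ : ℂ → ℂ) (J : ℂ) : Prop :=
  MeasureTheory.IntegrableOn (rayIntegrand θ α φ) (Set.Ioi 0) ∧
    ∫ t in Set.Ioi (0 : ℝ), rayIntegrand θ α φ t = J

/-- `J` is the Hadamard finite part of the integral of `p ^ (α - 1) * φ p` along the ray
from `0` to infinity with direction `exp (i θ)`, where `φ` is analytic near `0` and `α` is not one
of `0, -1, -2, …`: with `x = R * exp (i θ)` inside a disk of analyticity of `φ = ∑ φₙ pⁿ`, the
part of the integral from `0` to `x` is `∑ φₙ / (n + α) * x ^ (n + α)`, and the part from `x` to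
infinity is a Lebesgue integral. The result is the same for all such `R`. -/
def HasRayFinitePart (θ : ℝ) (α : ℂ) (φ : ℂ → ℂ) (J : ℂ) : Prop :=
  (∀ n : ℕ, α ≠ -(n : ℂ)) ∧
  ∃ r : ℝ, 0 < r ∧ DifferentiableOn ℂ φ (Metric.ball 0 r) ∧
    ∀ R ∈ Set.Ioo 0 r, ∃ S : ℂ,
      HasSum (fun n : ℕ => (iteratedDeriv n φ 0 / (n.factorial : ℂ)) / ((n : ℂ) + α) *
        ((R : ℂ) * Complex.exp (θ * Complex.I)) ^ ((n : ℂ) + α)) S ∧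
      MeasureTheory.IntegrableOn (rayIntegrand θ α φ) (Set.Ioi R) ∧
      J = S + ∫ t in Set.Ioi R, rayIntegrand θ α φ t

/-- `J` is the value of `∫ p ^ (α - 1) * φ p dp` along the ray with direction `exp (i θ)`: the
Lebesgue integral if `0 < Re α`, the Hadamard finite part if `Re α ≤ 0`. -/
def HasRayValue (θ : ℝ) (α : ℂ) (φ : ℂ → ℂ) (J : ℂ) : Prop :=
  (0 < α.re → HasRayIntegral θ α φ J) ∧ (α.re ≤ 0 → HasRayFinitePart θ α φ J)

/-- `J` is the Écalle medianization of `∫ p ^ (α - 1) * φ p dp` over the positive half-line: the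
average of the integrals along the rays from `0` just above and just below the half-line (the
integrals along all rays of small positive, respectively negative, angle agree). -/
def HasMedianValue (α : ℂ) (φ : ℂ → ℂ) (J : ℂ) : Prop :=
  ∃ Jabove Jbelow : ℂ,
    (∀ᶠ θ : ℝ in 𝓝[>] 0, HasRayValue θ α φ Jabove) ∧
    (∀ᶠ θ : ℝ in 𝓝[<] 0, HasRayValue θ α φ Jbelow) ∧
    J = (1 / 2) * Jbelow + (1 / 2) * Jabove

/-- `u` is the value at `(a, y)` of
`e^{-y/4} / Γ(1/4 + a/2) * ∫_0^∞ e^{-py} p^{a/2 - 3/4} (1 + 2p)^{-a/2 - 3/4} dp`. -/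
def IsUMinusValue (a y u : ℂ) : Prop :=
  ∃ J : ℂ,
    HasRayValue 0 (1 / 4 + a / 2)
      (fun p => Complex.exp (-(p * y)) * (1 + 2 * p) ^ (-a / 2 - 3 / 4)) J ∧
    u = 1 / Complex.Gamma (1 / 4 + a / 2) * Complex.exp (-y / 4) * J

/-- `u` is the value at `(a, y)` of
`e^{y/4} / Γ(1/4 - a/2) * M∫_0^∞ e^{-py} p^{-3/4 - a/2} (1 - 2p)^{-3/4 + a/2} dp`. The principal
branch of the last factor, used off the real line, continues `arg (1 - 2p) = 0` on `(0, 1/2)`. -/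
def IsUPlusValue (a y u : ℂ) : Prop :=
  ∃ J : ℂ,
    HasMedianValue (1 / 4 - a / 2)
      (fun p => Complex.exp (-(p * y)) * (1 - 2 * p) ^ (-3 / 4 + a / 2)) J ∧
    u = Complex.exp (y / 4) / Complex.Gamma (1 / 4 - a / 2) * J

/-!
`U` and `V` are defined as the combinations of the even and the odd solution of Weber's equation
(`e^{-z²/4}` times a Kummer series in `z² / 2`) that have the prescribed values and derivatives at
`0`. As `1 / Γ` is entire, both are entire in `(a, z)`, and `u₋(a, y) = U(a, √y)` and
`u₊(a, y) = √(π/2) V(a, √y)` are entire in `a` without further work. What has to be proved is that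
these functions are given by the integrals.

All the integrals in question reduce, on their ray, to the single function
`K(α, c, Y) = ∫₀^∞ e^{-sY} s^{α-1} (1 + c s)^{-α-1/2} ds` with `c` in the slit plane and `0 < Re Y`:
for `U` the ray is the positive half-line, and for `V` the rays above and below it.
For `0 < Re α`, integrating a total derivative shows that
`Y ↦ K(α, c, Y)` satisfies a confluent hypergeometric equation (`laplaceIntegral_ode`), so that
`e^{-ζ²/4} K(α, c, Y)` with `ζ² = 2Y/c` satisfies Weber's equation in `ζ` with parameter
`2α - 1/2`. By the constancy of Wronskians (`eq_weber_of_tendsto`) it is determined by its initial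
values at `ζ = 0`: the value is a Beta integral (`laplaceIntegral_zero`), and the derivative is
found by the scaling `s = q / t²` (`tendsto_mul_laplaceIntegral_one`). These are the initial values
of a multiple of `U(2α - 1/2, ·)`, whence `laplaceIntegral_eq_parabolicU`.

For `Re α ≤ 0` the finite part is the sum of a series and of an integral away from the origin.
Both are analytic in `α` off the poles `0, -1, -2, …`, and the sum agrees with the Lebesgue integral
where `0 < Re α`; so the formula persists by the identity theorem (`hasRayValue_parabolicU`).

For `V` the factor `1 - 2p` is `1 + 2 e^{∓iπ} p`, so the two lateral integrals are multiples of
`U(-a, ± i z)`. Rotation by a right angle exchanges the parameters `a` and `-a` in Weber's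
equation, and by the reflection formula the average of the two is a multiple of `V(a, z)`
(`parabolicV_eq_average`). The connection formulas and the linear independence are identities
between initial values, which follow from the reflection and the duplication formula for `Γ`,
written for `1 / Γ` so as to hold at the poles too.
-/

/-! ### Integrals and series of holomorphic functions -/

/-- Differentiation under the integral sign for a holomorphic parameter. A local bound on the
integrand itself is enough, since Cauchy's estimate turns it into one on the derivative. -/
theorem hasDerivAt_integral_of_differentiableOn {μ : MeasureTheory.Measure ℝ} {F : ℂ → ℝ → ℂ}
    {F' : ℝ → ℂ} {w₀ : ℂ} {r : ℝ} (hr : 0 < r) {bound : ℝ → ℝ}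
    (hmeas : ∀ w ∈ Metric.ball w₀ r, MeasureTheory.AEStronglyMeasurable (F w) μ)
    (hdiff : ∀ᵐ t ∂μ, DifferentiableOn ℂ (fun w => F w t) (Metric.ball w₀ r))
    (hbound : ∀ᵐ t ∂μ, ∀ w ∈ Metric.ball w₀ r, ‖F w t‖ ≤ bound t)
    (hint : MeasureTheory.Integrable bound μ)
    (hF' : ∀ᵐ t ∂μ, HasDerivAt (fun w => F w t) (F' t) w₀) :
    MeasureTheory.Integrable F' μ ∧
      HasDerivAt (fun w => ∫ t, F w t ∂μ) (∫ t, F' t ∂μ) w₀ := by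
  have hw₀ : w₀ ∈ Metric.ball w₀ r := Metric.mem_ball_self hr
  have hsub : ∀ w ∈ Metric.ball w₀ (r / 2), Metric.closedBall w (r / 4) ⊆ Metric.ball w₀ r := by
    intro w hw z hz
    rw [Metric.mem_ball] at hw ⊢
    rw [Metric.mem_closedBall] at hz
    linarith [dist_triangle z w w₀]
  -- the derivative is measurable as a limit of difference quotients
  have hmeas' : MeasureTheory.AEStronglyMeasurable (fun t => deriv (fun w => F w t) w₀) μ := by
    have hseq : Tendsto (fun n : ℕ => w₀ + ((r / 2 * (1 / ((n : ℝ) + 1)) : ℝ) : ℂ)) atTop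
        (𝓝[≠] w₀) := by
      refine tendsto_nhdsWithin_iff.2 ⟨?_, Eventually.of_forall fun n => ?_⟩
      · have h1 : Tendsto (fun n : ℕ => r / 2 * (1 / ((n : ℝ) + 1))) atTop (𝓝 (r / 2 * 0)) :=
          tendsto_one_div_add_atTop_nhds_zero_nat.const_mul _
        have h2 := (Complex.continuous_ofReal.tendsto _).comp h1
        simpa using h2.const_add w₀
      · have : 0 < r / 2 * (1 / ((n : ℝ) + 1)) := by positivity
        simpa using ⟨hr.ne', by exact_mod_cast (Nat.succ_ne_zero n)⟩
    refine aestronglyMeasurable_of_tendsto_ae atTop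
      (f := fun (n : ℕ) t => slope (fun w => F w t) w₀
        (w₀ + ((r / 2 * (1 / ((n : ℝ) + 1)) : ℝ) : ℂ))) (fun n => ?_) ?_
    · simp only [slope_def_field, div_eq_mul_inv]
      have hmem : w₀ + ((r / 2 * (1 / ((n : ℝ) + 1)) : ℝ) : ℂ) ∈ Metric.ball w₀ r := by
        have h0 : 0 < r / 2 * (1 / ((n : ℝ) + 1)) := by positivity
        have h1 : 1 / ((n : ℝ) + 1) ≤ 1 := by
          rw [div_le_one (by positivity)]
          linarith [(Nat.cast_nonneg n : (0 : ℝ) ≤ n)]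
        rw [Metric.mem_ball, dist_eq_norm, add_sub_cancel_left, Complex.norm_real,
          Real.norm_of_nonneg h0.le]
        nlinarith
      exact ((hmeas _ hmem).sub (hmeas _ hw₀)).mul_const _
    · filter_upwards [hF'] with t ht
      rw [ht.deriv]
      exact (hasDerivAt_iff_tendsto_slope.1 ht).comp hseq
  have key := hasDerivAt_integral_of_dominated_loc_of_deriv_le (μ := μ) (F := F) (x₀ := w₀)
    (s := Metric.ball w₀ (r / 2)) (F' := fun w t => deriv (fun w => F w t) w)
    (bound := fun t => bound t / (r / 4))
    (Metric.ball_mem_nhds _ (by positivity))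
    (by filter_upwards [Metric.ball_mem_nhds w₀ hr] with w hw using hmeas w hw)
    (hint.mono' (hmeas w₀ hw₀) (by filter_upwards [hbound] with t ht using ht w₀ hw₀))
    hmeas'
    (by
      filter_upwards [hdiff, hbound] with t hd hb w hw
      refine Complex.norm_deriv_le_of_forall_mem_sphere_norm_le (by positivity) ?_ fun z hz =>
        hb z (hsub w hw (Metric.sphere_subset_closedBall hz))
      exact (hd.mono (hsub w hw)).diffContOnCl_ball subset_rfl)
    (hint.div_const _)
    (by
      filter_upwards [hdiff] with t hd w hw
      exact (hd.differentiableAt (Metric.isOpen_ball.mem_nhds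
        (hsub w hw (Metric.mem_closedBall_self (by positivity))))).hasDerivAt)
  have hae : (fun t => deriv (fun w => F w t) w₀) =ᵐ[μ] F' := by
    filter_upwards [hF'] with t ht using ht.deriv
  exact ⟨key.1.congr hae, by rw [← MeasureTheory.integral_congr_ae hae]; exact key.2⟩

/-- Cauchy's estimate for the Fréchet derivative of a bounded holomorphic function. -/
theorem norm_fderiv_le_of_norm_le {E : Type*} [NormedAddCommGroup E] [NormedSpace ℂ E]
    {f : E → ℂ} {x : E} {r C : ℝ} (hr : 0 < r) (hd : DifferentiableOn ℂ f (Metric.ball x r))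
    (hC : ∀ y ∈ Metric.ball x r, ‖f y‖ ≤ C) : ‖fderiv ℂ f x‖ ≤ C / (r / 2) := by
  have hC0 : 0 ≤ C := (norm_nonneg _).trans (hC x (Metric.mem_ball_self hr))
  refine ContinuousLinearMap.opNorm_le_bound _ (by positivity) fun v => ?_
  rcases eq_or_ne v 0 with rfl | hv
  · simp
  have hv' : 0 < ‖v‖ := norm_pos_iff.2 hv
  have hmem : ∀ t ∈ Metric.closedBall (0 : ℂ) (r / 2 / ‖v‖), x + t • v ∈ Metric.ball x r := by
    intro t ht
    rw [mem_closedBall_zero_iff, le_div_iff₀ hv'] at ht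
    rw [Metric.mem_ball, dist_eq_norm, add_sub_cancel_left, norm_smul]
    linarith
  have hline : ∀ t : ℂ, HasDerivAt (fun t : ℂ => x + t • v) v t := fun t => by
    simpa using ((hasDerivAt_id t).smul_const v).const_add x
  have hder : HasDerivAt (fun t : ℂ => f (x + t • v)) (fderiv ℂ f x v) 0 := by
    have h := (hd.differentiableAt (Metric.isOpen_ball.mem_nhds (Metric.mem_ball_self hr)))
    have h' : HasFDerivAt f (fderiv ℂ f x) (x + (0 : ℂ) • v) := by simpa using h.hasFDerivAt
    exact h'.comp_hasDerivAt 0 (hline 0)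
  have hdc : DifferentiableOn ℂ (fun t : ℂ => f (x + t • v))
      (Metric.closedBall (0 : ℂ) (r / 2 / ‖v‖)) :=
    hd.comp (fun t _ => (hline t).differentiableAt.differentiableWithinAt) hmem
  have h := Complex.norm_deriv_le_of_forall_mem_sphere_norm_le (C := C) (by positivity)
    (hdc.diffContOnCl_ball subset_rfl) fun z hz => hC _ (hmem z (Metric.sphere_subset_closedBall hz))
  rw [hder.deriv] at h
  refine h.trans (le_of_eq ?_)
  field_simp

/-- A normally convergent series of holomorphic functions, in several variables as well, is
differentiable term by term. -/
theorem hasFDerivAt_tsum_of_norm_le {E : Type*} [NormedAddCommGroup E] [NormedSpace ℂ E]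
    {f : ℕ → E → ℂ} {x : E} {r : ℝ} (hr : 0 < r) {u : ℕ → ℝ} (hu : Summable u)
    (hd : ∀ n, DifferentiableOn ℂ (f n) (Metric.ball x r))
    (hC : ∀ n, ∀ y ∈ Metric.ball x r, ‖f n y‖ ≤ u n) :
    Summable (fun n => fderiv ℂ (f n) x) ∧
      HasFDerivAt (fun y => ∑' n, f n y) (∑' n, fderiv ℂ (f n) x) x := by
  have hsub : ∀ y ∈ Metric.ball x (r / 2), Metric.ball y (r / 2) ⊆ Metric.ball x r :=
    fun y hy => Metric.ball_subset_ball' (by rw [Metric.mem_ball] at hy; linarith)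
  have hb : ∀ n, ∀ y ∈ Metric.ball x (r / 2), ‖fderiv ℂ (f n) y‖ ≤ u n / (r / 2 / 2) :=
    fun n y hy => norm_fderiv_le_of_norm_le (by positivity) ((hd n).mono (hsub y hy))
      fun z hz => hC n z (hsub y hy hz)
  have hx : x ∈ Metric.ball x (r / 2) := Metric.mem_ball_self (by positivity)
  refine ⟨Summable.of_norm_bounded (hu.div_const _) fun n => hb n x hx, ?_⟩
  refine hasFDerivAt_tsum_of_isPreconnected (hu.div_const _) Metric.isOpen_ball
    ?_ (fun n y hy => ?_) hb hx ?_ hx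
  · let : NormedSpace ℝ E := NormedSpace.restrictScalars ℝ ℂ E
    exact (convex_ball x (r / 2)).isPreconnected
  · exact ((hd n).differentiableAt (Metric.isOpen_ball.mem_nhds
      (hsub y hy (Metric.mem_ball_self (by positivity))))).hasFDerivAt
  · exact Summable.of_norm_bounded hu fun n => hC n x (Metric.mem_ball_self hr)

/-! ### Kummer's confluent hypergeometric series -/

/-- The coefficient `(A)ₙ / ((B)ₙ n!)` of Kummer's series. -/
noncomputable def kummerCoeff (A B : ℂ) (n : ℕ) : ℂ :=
  ∏ k ∈ Finset.range n, (A + k) / ((B + k) * (k + 1))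

/-- Kummer's confluent hypergeometric function `₁F₁(A; B; x)`. -/
noncomputable def kummerM (A B x : ℂ) : ℂ :=
  ∑' n : ℕ, kummerCoeff A B n * x ^ n

theorem kummerCoeff_zero (A B : ℂ) : kummerCoeff A B 0 = 1 := by simp [kummerCoeff]

theorem kummerCoeff_succ (A B : ℂ) (n : ℕ) :
    kummerCoeff A B (n + 1) = kummerCoeff A B n * ((A + n) / ((B + n) * (n + 1))) := by
  rw [kummerCoeff, kummerCoeff, Finset.prod_range_succ]

/-- The hypothesis `1 / 2 ≤ Re B` covers the parameters `1 / 2` and `3 / 2` of the even and the odd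
solution, as well as their shifts by natural numbers. -/
theorem norm_kummerCoeff_le {A B : ℂ} {K : ℝ} (hA : ‖A‖ ≤ K) (hB : 1 / 2 ≤ B.re) (n : ℕ) :
    ‖kummerCoeff A B n‖ ≤ (2 * K + 1) ^ n / n.factorial := by
  have hK : 0 ≤ K := (norm_nonneg _).trans hA
  induction n with
  | zero => simp [kummerCoeff_zero]
  | succ n ih =>
    rw [kummerCoeff_succ, norm_mul, Nat.factorial_succ, pow_succ]
    have h1 : ‖A + n‖ ≤ K + n := (norm_add_le _ _).trans (by simpa using hA)
    have h2 : 1 / 2 + (n : ℝ) ≤ ‖B + n‖ := by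
      refine le_trans ?_ (Complex.re_le_norm _)
      simpa using hB
    have hn : (0 : ℝ) ≤ n := Nat.cast_nonneg n
    have h3 : ‖(A + n) / ((B + n) * (n + 1))‖ ≤ (2 * K + 1) / (n + 1) := by
      have hn1 : ‖(n : ℂ) + 1‖ = n + 1 := by
        have : ‖((n + 1 : ℝ) : ℂ)‖ = n + 1 := by
          rw [Complex.norm_real, Real.norm_of_nonneg (by positivity)]
        simpa using this
      rw [norm_div, norm_mul, hn1, div_le_div_iff₀ (by nlinarith) (by positivity)]
      have h4 : ‖A + n‖ ≤ (2 * K + 1) * ‖B + n‖ := by nlinarith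
      nlinarith
    calc ‖kummerCoeff A B n‖ * ‖(A + n) / ((B + n) * (n + 1))‖
        ≤ (2 * K + 1) ^ n / n.factorial * ((2 * K + 1) / (n + 1)) := by gcongr
      _ = _ := by
        push_cast
        field_simp

theorem norm_kummer_term_le {A B x : ℂ} {K X : ℝ} (hA : ‖A‖ ≤ K) (hB : 1 / 2 ≤ B.re)
    (hx : ‖x‖ ≤ X) (n : ℕ) :
    ‖kummerCoeff A B n * x ^ n‖ ≤ ((2 * K + 1) * X) ^ n / n.factorial := by
  have hK : 0 ≤ K := (norm_nonneg _).trans hA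
  rw [norm_mul, norm_pow, mul_pow, mul_div_right_comm]
  have := norm_kummerCoeff_le hA hB n
  gcongr

theorem hasSum_kummerM {A B : ℂ} (hB : 1 / 2 ≤ B.re) (x : ℂ) :
    HasSum (fun n : ℕ => kummerCoeff A B n * x ^ n) (kummerM A B x) :=
  (Summable.of_norm_bounded (Real.summable_pow_div_factorial _)
    (norm_kummer_term_le le_rfl hB le_rfl)).hasSum

theorem differentiable_kummerM {B : ℂ} (hB : 1 / 2 ≤ B.re) :
    Differentiable ℂ (fun q : ℂ × ℂ => kummerM q.1 B q.2) := by
  intro q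
  refine (hasFDerivAt_tsum_of_norm_le (f := fun n (q : ℂ × ℂ) => kummerCoeff q.1 B n * q.2 ^ n)
    (x := q) one_pos (Real.summable_pow_div_factorial ((2 * (‖q‖ + 1) + 1) * (‖q‖ + 1)))
    (fun n => ?_) (fun n y hy => ?_)).2.differentiableAt
  · refine Differentiable.differentiableOn ?_
    simp only [kummerCoeff]
    fun_prop
  · have hy' : ‖y‖ ≤ ‖q‖ + 1 := by
      rw [Metric.mem_ball, dist_eq_norm] at hy
      have := norm_add_le q (y - q)
      rw [add_sub_cancel] at this
      linarith
    exact norm_kummer_term_le ((norm_fst_le y).trans hy') hB ((norm_snd_le y).trans hy') n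

theorem succ_mul_kummerCoeff_succ {A B : ℂ} (hB : 1 / 2 ≤ B.re) (n : ℕ) :
    ((n : ℂ) + 1) * kummerCoeff A B (n + 1) = A / B * kummerCoeff (A + 1) (B + 1) n := by
  have hBk : ∀ k : ℕ, B + k ≠ 0 := fun k h => by
    have := congrArg Complex.re h
    simp at this
    linarith [(Nat.cast_nonneg k : (0 : ℝ) ≤ k)]
  have hB0 : B ≠ 0 := by simpa using hBk 0
  induction n with
  | zero => simp [kummerCoeff_succ, kummerCoeff_zero]
  | succ n ih =>
    have h1 : ((n : ℂ) + 1) ≠ 0 := by exact_mod_cast Nat.succ_ne_zero n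
    have h2 : ((n : ℂ) + 1 + 1) ≠ 0 := by exact_mod_cast Nat.succ_ne_zero (n + 1)
    have h3 : B + (n + 1) ≠ 0 := by simpa using hBk (n + 1)
    have h4 : B + 1 + n ≠ 0 := by rwa [add_assoc, add_comm 1]
    rw [kummerCoeff_succ A B (n + 1), kummerCoeff_succ (A + 1), ← mul_assoc (A / B), ← ih]
    push_cast
    field_simp
    ring

/-- The termwise derivative of Kummer's series is a Kummer series with shifted parameters. -/
theorem hasSum_deriv_kummerM {A B : ℂ} (hB : 1 / 2 ≤ B.re) (x : ℂ) :
    HasSum (fun n : ℕ => ((n : ℂ) + 1) * kummerCoeff A B (n + 1) * x ^ n)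
      (A / B * kummerM (A + 1) (B + 1) x) := by
  simp_rw [succ_mul_kummerCoeff_succ hB, mul_assoc]
  exact (hasSum_kummerM (by simp; linarith) x).mul_left _

theorem hasDerivAt_kummerM {A B : ℂ} (hB : 1 / 2 ≤ B.re) (x : ℂ) :
    HasDerivAt (kummerM A B) (A / B * kummerM (A + 1) (B + 1) x) x := by
  obtain ⟨h1, h2⟩ := hasFDerivAt_tsum_of_norm_le (f := fun n x => kummerCoeff A B n * x ^ n)
    (x := x) one_pos (Real.summable_pow_div_factorial ((2 * ‖A‖ + 1) * (‖x‖ + 1)))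
    (fun n => by fun_prop) (fun n y hy => norm_kummer_term_le le_rfl hB (by
      rw [Metric.mem_ball, dist_eq_norm] at hy
      have := norm_add_le x (y - x)
      rw [add_sub_cancel] at this
      linarith) n)
  have h3 := h2.hasDerivAt
  have h4 : HasSum (fun n : ℕ => (fderiv ℂ (fun x => kummerCoeff A B n * x ^ n) x) 1)
      ((∑' n : ℕ, fderiv ℂ (fun x => kummerCoeff A B n * x ^ n) x) 1) :=
    (ContinuousLinearMap.apply ℂ ℂ (1 : ℂ)).hasSum h1.hasSum
  have h5 : ∀ n : ℕ, (fderiv ℂ (fun x => kummerCoeff A B n * x ^ n) x) 1 =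
      kummerCoeff A B n * (n * x ^ (n - 1)) := fun n => by
    have : HasDerivAt (fun x : ℂ => kummerCoeff A B n * x ^ n)
      (kummerCoeff A B n * (n * x ^ (n - 1))) x := (hasDerivAt_pow n x).const_mul _
    rw [fderiv_apply_one_eq_deriv, this.deriv]
  simp_rw [h5] at h4
  rw [← hasSum_nat_add_iff' 1] at h4
  have h6 := h4.unique ((hasSum_deriv_kummerM (A := A) hB x).congr_fun ?_)
  · simp only [Finset.range_one, Finset.sum_singleton, Nat.cast_zero, zero_mul, mul_zero,
      sub_zero] at h6
    rw [← h6]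
    exact h3
  · intro n
    push_cast
    ring

theorem kummerM_zero (A B : ℂ) : kummerM A B 0 = 1 := by
  rw [kummerM, tsum_eq_single 0 (fun n hn => by simp [hn])]
  simp [kummerCoeff_zero]

/-- Kummer's equation `x M'' + (B - x) M' - A M = 0`. -/
theorem kummerM_ode {A B : ℂ} (hB : 1 / 2 ≤ B.re) (x : ℂ) :
    x * (A / B * ((A + 1) / (B + 1) * kummerM (A + 2) (B + 2) x)) +
      (B - x) * (A / B * kummerM (A + 1) (B + 1) x) - A * kummerM A B x = 0 := by
  have hB1 : 1 / 2 ≤ (B + 1).re := by simp; linarith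
  have hBk : ∀ k : ℕ, B + k ≠ 0 := fun k h => by
    have := congrArg Complex.re h
    simp at this
    linarith [(Nat.cast_nonneg k : (0 : ℝ) ≤ k)]
  have h0 := hasSum_kummerM (A := A) hB x
  have h1 := hasSum_deriv_kummerM (A := A) hB x
  have hx1 : HasSum (fun n : ℕ => (n : ℂ) * kummerCoeff A B n * x ^ n)
      (x * (A / B * kummerM (A + 1) (B + 1) x)) := by
    rw [← hasSum_nat_add_iff' 1]
    simpa [pow_succ, mul_comm, mul_left_comm, mul_assoc] using h1.mul_left x
  have hx2 : HasSum (fun n : ℕ => (n : ℂ) * (((n : ℂ) + 1) * kummerCoeff A B (n + 1)) * x ^ n)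
      (x * (A / B * ((A + 1) / (B + 1) * kummerM (A + 2) (B + 2) x))) := by
    have h2 := ((hasSum_deriv_kummerM (A := A + 1) hB1 x).mul_left (A / B)).mul_left x
    rw [← hasSum_nat_add_iff' 1]
    simp_rw [succ_mul_kummerCoeff_succ hB]
    rw [show A + 1 + 1 = A + 2 by ring, show B + 1 + 1 = B + 2 by ring] at h2
    convert! h2 using 1
    · ext n
      push_cast
      ring
    · simp
  have h := (hx2.add ((h1.mul_left B).sub hx1)).sub (h0.mul_left A)
  have hz := h.unique (hasSum_zero.congr_fun fun n => ?_)
  · rw [← hz]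
    ring
  · have h3 : ((n : ℂ) + 1) ≠ 0 := by exact_mod_cast Nat.succ_ne_zero n
    have h4 := hBk n
    rw [kummerCoeff_succ]
    field_simp
    ring

/-! ### The even and the odd solution of Weber's equation -/

/-- The even solution of `w'' = (z² / 4 + a) w`, with value `1` at `0`. -/
noncomputable def weberEven (a z : ℂ) : ℂ :=
  Complex.exp (-z ^ 2 / 4) * kummerM (a / 2 + 1 / 4) (1 / 2) (z ^ 2 / 2)

/-- The odd solution of `w'' = (z² / 4 + a) w`, with derivative `1` at `0`. -/
noncomputable def weberOdd (a z : ℂ) : ℂ :=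
  z * (Complex.exp (-z ^ 2 / 4) * kummerM (a / 2 + 3 / 4) (3 / 2) (z ^ 2 / 2))

/-- The derivative of `weberEven a`. -/
noncomputable def weberEvenDeriv (a z : ℂ) : ℂ :=
  Complex.exp (-z ^ 2 / 4) * (-(z / 2) * kummerM (a / 2 + 1 / 4) (1 / 2) (z ^ 2 / 2) +
    z * ((a / 2 + 1 / 4) / (1 / 2) * kummerM (a / 2 + 1 / 4 + 1) (1 / 2 + 1) (z ^ 2 / 2)))

/-- The derivative of `weberOdd a`. -/
noncomputable def weberOddDeriv (a z : ℂ) : ℂ :=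
  Complex.exp (-z ^ 2 / 4) * ((1 - z ^ 2 / 2) * kummerM (a / 2 + 3 / 4) (3 / 2) (z ^ 2 / 2) +
    z ^ 2 * ((a / 2 + 3 / 4) / (3 / 2) * kummerM (a / 2 + 3 / 4 + 1) (3 / 2 + 1) (z ^ 2 / 2)))

theorem hasDerivAt_exp_neg_sq_div_four (z : ℂ) :
    HasDerivAt (fun z : ℂ => Complex.exp (-z ^ 2 / 4))
      (-(z / 2) * Complex.exp (-z ^ 2 / 4)) z := by
  have h : HasDerivAt (fun z : ℂ => -z ^ 2 / 4) (-(z / 2)) z := by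
    convert! ((hasDerivAt_pow 2 z).neg.div_const 4) using 1
    push_cast
    ring
  convert! h.cexp using 1
  ring

theorem hasDerivAt_kummerM_sq_half {A B : ℂ} (hB : 1 / 2 ≤ B.re) (z : ℂ) :
    HasDerivAt (fun z : ℂ => kummerM A B (z ^ 2 / 2))
      (z * (A / B * kummerM (A + 1) (B + 1) (z ^ 2 / 2))) z := by
  have h : HasDerivAt (fun z : ℂ => z ^ 2 / 2) z z := by
    convert! ((hasDerivAt_pow 2 z).div_const 2) using 1
    push_cast
    ring
  convert! (hasDerivAt_kummerM (A := A) hB (z ^ 2 / 2)).comp z h using 1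
  ring

theorem hasDerivAt_weberEven (a z : ℂ) :
    HasDerivAt (weberEven a) (weberEvenDeriv a z) z := by
  convert! (hasDerivAt_exp_neg_sq_div_four z).mul
    (hasDerivAt_kummerM_sq_half (A := a / 2 + 1 / 4) (B := 1 / 2) (by norm_num) z) using 1
  rw [weberEvenDeriv]
  ring

theorem hasDerivAt_weberOdd (a z : ℂ) :
    HasDerivAt (weberOdd a) (weberOddDeriv a z) z := by
  convert! (hasDerivAt_id z).mul ((hasDerivAt_exp_neg_sq_div_four z).mul
    (hasDerivAt_kummerM_sq_half (A := a / 2 + 3 / 4) (B := 3 / 2) (by norm_num) z)) using 1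
  rw [weberOddDeriv]
  simp only [id, Pi.mul_apply]
  ring

/-- Weber's equation for the even solution. -/
theorem hasDerivAt_weberEvenDeriv (a z : ℂ) :
    HasDerivAt (weberEvenDeriv a) ((z ^ 2 / 4 + a) * weberEven a z) z := by
  have hM := hasDerivAt_kummerM_sq_half (A := a / 2 + 1 / 4) (B := 1 / 2) (by norm_num) z
  have hM1 := hasDerivAt_kummerM_sq_half (A := a / 2 + 1 / 4 + 1) (B := 1 / 2 + 1) (by norm_num) z
  have ode := kummerM_ode (A := a / 2 + 1 / 4) (B := 1 / 2) (by norm_num) (z ^ 2 / 2)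
  convert! (hasDerivAt_exp_neg_sq_div_four z).mul
    ((((hasDerivAt_id z).div_const 2).neg.mul hM).add
      ((hasDerivAt_id z).mul (hM1.const_mul ((a / 2 + 1 / 4) / (1 / 2))))) using 1
  rw [weberEven]
  rw [show a / 2 + 1 / 4 + 1 + 1 = a / 2 + 1 / 4 + 2 by ring,
    show (1 / 2 + 1 + 1 : ℂ) = 1 / 2 + 2 by ring]
  simp only [id, Pi.mul_apply, Pi.add_apply, Pi.neg_apply]
  linear_combination (-2 * Complex.exp (-z ^ 2 / 4)) * ode

/-- Weber's equation for the odd solution. -/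
theorem hasDerivAt_weberOddDeriv (a z : ℂ) :
    HasDerivAt (weberOddDeriv a) ((z ^ 2 / 4 + a) * weberOdd a z) z := by
  have hM := hasDerivAt_kummerM_sq_half (A := a / 2 + 3 / 4) (B := 3 / 2) (by norm_num) z
  have hM1 := hasDerivAt_kummerM_sq_half (A := a / 2 + 3 / 4 + 1) (B := 3 / 2 + 1) (by norm_num) z
  have ode := kummerM_ode (A := a / 2 + 3 / 4) (B := 3 / 2) (by norm_num) (z ^ 2 / 2)
  convert! (hasDerivAt_exp_neg_sq_div_four z).mul
    (((((hasDerivAt_pow 2 z).div_const 2).const_sub 1).mul hM).add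
      ((hasDerivAt_pow 2 z).mul (hM1.const_mul ((a / 2 + 3 / 4) / (3 / 2))))) using 1
  rw [weberOdd]
  rw [show a / 2 + 3 / 4 + 1 + 1 = a / 2 + 3 / 4 + 2 by ring,
    show (3 / 2 + 1 + 1 : ℂ) = 3 / 2 + 2 by ring]
  simp only [Pi.mul_apply, Pi.add_apply]
  push_cast
  linear_combination (-2 * z * Complex.exp (-z ^ 2 / 4)) * ode

theorem differentiable_weberEven : Differentiable ℂ (fun q : ℂ × ℂ => weberEven q.1 q.2) := by
  have h : Differentiable ℂ (fun q : ℂ × ℂ => (q.1 / 2 + 1 / 4, q.2 ^ 2 / 2)) := by fun_prop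
  have h2 := (differentiable_kummerM (B := 1 / 2) (by norm_num)).comp h
  refine Differentiable.mul (by fun_prop) h2

theorem differentiable_weberOdd : Differentiable ℂ (fun q : ℂ × ℂ => weberOdd q.1 q.2) := by
  have h : Differentiable ℂ (fun q : ℂ × ℂ => (q.1 / 2 + 3 / 4, q.2 ^ 2 / 2)) := by fun_prop
  have h2 := (differentiable_kummerM (B := 3 / 2) (by norm_num)).comp h
  exact differentiable_snd.mul (Differentiable.mul (by fun_prop) h2)

theorem weberEven_zero (a : ℂ) : weberEven a 0 = 1 := by simp [weberEven, kummerM_zero]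
theorem weberOdd_zero (a : ℂ) : weberOdd a 0 = 0 := by simp [weberOdd]
theorem weberEvenDeriv_zero (a : ℂ) : weberEvenDeriv a 0 = 0 := by simp [weberEvenDeriv]
theorem weberOddDeriv_zero (a : ℂ) : weberOddDeriv a 0 = 1 := by
  simp [weberOddDeriv, kummerM_zero]
theorem weberEven_neg (a z : ℂ) : weberEven a (-z) = weberEven a z := by simp [weberEven]
theorem weberOdd_neg (a z : ℂ) : weberOdd a (-z) = -weberOdd a z := by simp [weberOdd]

theorem weber_wronskian (a z : ℂ) :
    weberEven a z * weberOddDeriv a z - weberEvenDeriv a z * weberOdd a z = 1 := by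
  have h : ∀ x, HasDerivAt (fun z => weberEven a z * weberOddDeriv a z -
      weberEvenDeriv a z * weberOdd a z) 0 x := fun x => by
    convert! ((hasDerivAt_weberEven a x).mul (hasDerivAt_weberOddDeriv a x)).sub
      ((hasDerivAt_weberEvenDeriv a x).mul (hasDerivAt_weberOdd a x)) using 1
    ring
  have := is_const_of_deriv_eq_zero (fun x => (h x).differentiableAt) (fun x => (h x).deriv) z 0
  simpa [weberEven_zero, weberOdd_zero, weberEvenDeriv_zero, weberOddDeriv_zero] using this

/-- A function on `(0, ∞)` solving Weber's equation along the ray through `ζ` is determined by its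
limiting initial values at `0`: its Wronskians with the even and the odd solution are constant,
hence equal to their limits. -/
theorem eq_weber_of_tendsto {a ζ g₀ g₁ : ℂ} {g g' : ℝ → ℂ}
    (hg : ∀ t : ℝ, 0 < t → HasDerivAt g (g' t) t)
    (hg' : ∀ t : ℝ, 0 < t → HasDerivAt g' (ζ ^ 2 * ((t * ζ) ^ 2 / 4 + a) * g t) t)
    (h₀ : Tendsto g (𝓝[>] 0) (𝓝 g₀)) (h₁ : Tendsto g' (𝓝[>] 0) (𝓝 (ζ * g₁)))
    {t : ℝ} (ht : 0 < t) :
    ζ * g t = ζ * (g₀ * weberEven a (t * ζ) + g₁ * weberOdd a (t * ζ)) := by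
  have hline : ∀ t : ℝ, HasDerivAt (fun t : ℝ => (t : ℂ) * ζ) ζ t := fun t => by
    simpa using (Complex.ofRealCLM.hasDerivAt (x := t)).mul_const ζ
  have wronskian_const : ∀ w w' : ℂ → ℂ, (∀ z, HasDerivAt w (w' z) z) →
      (∀ z, HasDerivAt w' ((z ^ 2 / 4 + a) * w z) z) →
      g t * (ζ * w' (t * ζ)) - g' t * w (t * ζ) = g₀ * (ζ * w' 0) - ζ * g₁ * w 0 := by
    intro w w' hw hw'
    have hd : ∀ s : ℝ, 0 < s →
        HasDerivAt (fun s : ℝ => g s * (ζ * w' (s * ζ)) - g' s * w (s * ζ)) 0 s := by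
      intro s hs
      have h1 := (hw (s * ζ)).scomp s (hline s)
      have h2 := ((hw' (s * ζ)).scomp s (hline s)).const_mul ζ
      convert! ((hg s hs).mul h2).sub ((hg' s hs).mul h1) using 1
      simp only [smul_eq_mul, Function.comp]
      ring
    have hconst : ∀ s : ℝ, 0 < s → g s * (ζ * w' (s * ζ)) - g' s * w (s * ζ) =
        g t * (ζ * w' (t * ζ)) - g' t * w (t * ζ) := by
      intro s hs
      exact isOpen_Ioi.is_const_of_deriv_eq_zero isPreconnected_Ioi
        (fun x hx => (hd x hx).differentiableAt.differentiableWithinAt)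
        (fun x hx => (hd x hx).deriv) hs ht
    have hc : ∀ w : ℂ → ℂ, Continuous w →
        Tendsto (fun s : ℝ => w (s * ζ)) (𝓝[>] 0) (𝓝 (w 0)) := by
      intro w hw
      have : Continuous fun s : ℝ => w (s * ζ) := by fun_prop
      simpa using (this.tendsto 0).mono_left nhdsWithin_le_nhds
    have hl := (h₀.mul ((hc w' (continuous_iff_continuousAt.2
      fun z => (hw' z).continuousAt)).const_mul ζ)).sub
      (h₁.mul (hc w (continuous_iff_continuousAt.2 fun z => (hw z).continuousAt)))
    refine tendsto_nhds_unique ?_ hl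
    refine tendsto_const_nhds.congr' ?_
    filter_upwards [self_mem_nhdsWithin] with s hs using (hconst s hs).symm
  have hE := wronskian_const _ _ (hasDerivAt_weberEven a) (hasDerivAt_weberEvenDeriv a)
  have hO := wronskian_const _ _ (hasDerivAt_weberOdd a) (hasDerivAt_weberOddDeriv a)
  have hW := weber_wronskian a (t * ζ)
  rw [weberEven_zero, weberEvenDeriv_zero] at hE
  rw [weberOdd_zero, weberOddDeriv_zero] at hO
  linear_combination (-ζ * g t) * hW + weberEven a (t * ζ) * hO - weberOdd a (t * ζ) * hE

/-- Rotation by a right angle exchanges the parameters `a` and `-a`. -/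
theorem weber_rotate {w w' : ℂ → ℂ} (a z : ℂ) (hw : ∀ z, HasDerivAt w (w' z) z)
    (hw' : ∀ z, HasDerivAt w' ((z ^ 2 / 4 + -a) * w z) z) :
    w (Complex.I * z) = w 0 * weberEven a z + Complex.I * w' 0 * weberOdd a z := by
  rcases eq_or_ne z 0 with rfl | hz
  · simp [weberEven_zero, weberOdd_zero]
  have hline : ∀ t : ℝ, HasDerivAt (fun t : ℝ => Complex.I * (t * z)) (Complex.I * z) t := fun t => by
    simpa using ((Complex.ofRealCLM.hasDerivAt (x := t)).mul_const z).const_mul Complex.I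
  have hlim : ∀ f : ℂ → ℂ, Continuous f →
      Tendsto (fun s : ℝ => f (Complex.I * (s * z))) (𝓝[>] 0) (𝓝 (f 0)) := by
    intro f hf
    have : Continuous fun s : ℝ => f (Complex.I * (s * z)) := by fun_prop
    simpa using (this.tendsto 0).mono_left nhdsWithin_le_nhds
  have h := eq_weber_of_tendsto (a := a) (ζ := z) (g₀ := w 0) (g₁ := Complex.I * w' 0)
    (g := fun t : ℝ => w (Complex.I * (t * z)))
    (g' := fun t : ℝ => Complex.I * z * w' (Complex.I * (t * z)))
    (fun t _ => by
      convert! (hw (Complex.I * (t * z))).scomp t (hline t) using 1)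
    (fun t _ => by
      convert! ((hw' (Complex.I * (t * z))).scomp t (hline t)).const_mul (Complex.I * z) using 1
      simp only [smul_eq_mul]
      linear_combination (w (Complex.I * (t * z)) * z ^ 2 *
        (a - t ^ 2 * z ^ 2 / 4 * (Complex.I ^ 2 - 1))) * Complex.I_sq)
    (hlim w (continuous_iff_continuousAt.2 fun z => (hw z).continuousAt))
    (by
      convert! (hlim w' (continuous_iff_continuousAt.2
        fun z => (hw' z).continuousAt)).const_mul (Complex.I * z) using 2
      ring)
    one_pos
  simpa using mul_left_cancel₀ hz h

theorem weberEven_neg_I_mul (a z : ℂ) : weberEven (-a) (Complex.I * z) = weberEven a z := by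
  rw [weber_rotate a z (hasDerivAt_weberEven (-a)) (hasDerivAt_weberEvenDeriv (-a)),
    weberEven_zero, weberEvenDeriv_zero]
  ring

theorem weberOdd_neg_I_mul (a z : ℂ) :
    weberOdd (-a) (Complex.I * z) = Complex.I * weberOdd a z := by
  rw [weber_rotate a z (hasDerivAt_weberOdd (-a)) (hasDerivAt_weberOddDeriv (-a)),
    weberOdd_zero, weberOddDeriv_zero]
  ring

/-! ### Laplace integrals along a ray: convergence and differential equation -/

theorem add_mul_mem_slitPlane {c : ℂ} (hc : c ∈ Complex.slitPlane) {x s : ℝ} (hx : 0 ≤ x)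
    (hs : 0 ≤ s) (h : 0 < x + s) : (x : ℂ) + c * s ∈ Complex.slitPlane := by
  rw [Complex.mem_slitPlane_iff] at hc ⊢
  simp only [Complex.add_re, Complex.ofReal_re, Complex.re_mul_ofReal, Complex.add_im,
    Complex.ofReal_im, Complex.im_mul_ofReal, zero_add]
  rcases hs.eq_or_lt with rfl | hs
  · left
    simpa using h
  · rcases hc with hc | hc
    · left
      positivity
    · right
      exact mul_ne_zero hc hs.ne'

theorem one_add_mul_mem_slitPlane {c : ℂ} (hc : c ∈ Complex.slitPlane) {s : ℝ} (hs : 0 ≤ s) :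
    1 + c * s ∈ Complex.slitPlane := by
  simpa using add_mul_mem_slitPlane hc zero_le_one hs (by positivity)

/-- By homogeneity it is enough to bound `‖x + c s‖` from below on the compact segment `x + s = 1`. -/
theorem exists_le_norm_add_mul {c : ℂ} (hc : c ∈ Complex.slitPlane) :
    ∃ κ : ℝ, 0 < κ ∧ ∀ x s : ℝ, 0 ≤ x → 0 ≤ s → κ * (x + s) ≤ ‖(x : ℂ) + c * s‖ := by
  obtain ⟨u, hu, hmin⟩ := isCompact_Icc.exists_isMinOn (Set.nonempty_Icc.2 zero_le_one)
    (f := fun u : ℝ => ‖((1 - u : ℝ) : ℂ) + c * u‖) (by fun_prop)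
  refine ⟨‖((1 - u : ℝ) : ℂ) + c * u‖, norm_pos_iff.2 (Complex.slitPlane_ne_zero
    (add_mul_mem_slitPlane hc (by linarith [hu.2]) hu.1 (by linarith))), fun x s hx hs => ?_⟩
  rcases (add_nonneg hx hs).eq_or_lt with h | h
  · rw [← h, mul_zero]
    exact norm_nonneg _
  · have hm : s / (x + s) ∈ Set.Icc (0 : ℝ) 1 :=
      ⟨by positivity, by rw [div_le_one h]; linarith⟩
    have h1 := isMinOn_iff.1 hmin _ hm
    have h2 : (x : ℂ) + c * s = (x + s : ℝ) * (((1 - s / (x + s) : ℝ) : ℂ) + c * (s / (x + s) : ℝ)) := by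
      have : (x : ℂ) + s ≠ 0 := by exact_mod_cast h.ne'
      push_cast
      field_simp
      ring
    rw [h2, norm_mul, Complex.norm_real, Real.norm_of_nonneg h.le, mul_comm]
    gcongr

theorem norm_add_mul_le (c : ℂ) {x s : ℝ} (hx : 0 ≤ x) (hs : 0 ≤ s) :
    ‖(x : ℂ) + c * s‖ ≤ (1 + ‖c‖) * (x + s) := by
  refine (norm_add_le _ _).trans ?_
  rw [norm_mul, Complex.norm_real, Complex.norm_real, Real.norm_of_nonneg hx,
    Real.norm_of_nonneg hs]
  nlinarith [norm_nonneg c, mul_nonneg (norm_nonneg c) hx]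

theorem norm_cpow_le_of_norm_bounds {z β : ℂ} {κ L m : ℝ} (hκ : 0 < κ) (hm : 0 < m)
    (h1 : κ * m ≤ ‖z‖) (h2 : ‖z‖ ≤ L * m) :
    ‖z ^ β‖ ≤ (L ^ β.re + κ ^ β.re) * Real.exp (Real.pi * |β.im|) * m ^ β.re := by
  have hz : 0 < ‖z‖ := (by positivity : 0 < κ * m).trans_le h1
  have hL : 0 < L := by
    by_contra h
    nlinarith
  rw [Complex.norm_cpow_of_ne_zero (norm_pos_iff.1 hz), div_eq_mul_inv, ← Real.exp_neg]
  have he : -(z.arg * β.im) ≤ Real.pi * |β.im| := by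
    refine (neg_le_abs _).trans ?_
    rw [abs_mul]
    exact mul_le_mul_of_nonneg_right (Complex.abs_arg_le_pi z) (abs_nonneg _)
  have hp : ‖z‖ ^ β.re ≤ (L ^ β.re + κ ^ β.re) * m ^ β.re := by
    rw [add_mul, ← Real.mul_rpow hL.le hm.le, ← Real.mul_rpow hκ.le hm.le]
    rcases le_total 0 β.re with h | h
    · have := Real.rpow_le_rpow (norm_nonneg z) h2 h
      have : 0 ≤ (κ * m) ^ β.re := by positivity
      linarith
    · have := Real.rpow_le_rpow_of_nonpos (by positivity) h1 h
      have : 0 ≤ (L * m) ^ β.re := by positivity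
      linarith
  calc ‖z‖ ^ β.re * Real.exp (-(z.arg * β.im))
      ≤ (L ^ β.re + κ ^ β.re) * m ^ β.re * Real.exp (Real.pi * |β.im|) := by gcongr
    _ = _ := by ring

theorem one_add_rpow_le_exp {q ε : ℝ} (hε : 0 < ε) :
    ∃ C : ℝ, 0 ≤ C ∧ ∀ s : ℝ, 0 ≤ s → (1 + s) ^ q ≤ C * Real.exp (ε * s) := by
  obtain ⟨N, hN⟩ := exists_nat_ge q
  refine ⟨N.factorial / ε ^ N * Real.exp ε, by positivity, fun s hs => ?_⟩
  have h1 : (1 + s) ^ q ≤ (1 + s) ^ N := by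
    rw [← Real.rpow_natCast]
    exact Real.rpow_le_rpow_of_exponent_le (by linarith) hN
  have h2 := Real.pow_div_factorial_le_exp (ε * (1 + s)) (by positivity) N
  rw [mul_pow, div_le_iff₀ (by positivity)] at h2
  have h3 : Real.exp (ε * (1 + s)) = Real.exp ε * Real.exp (ε * s) := by
    rw [← Real.exp_add]
    ring_nf
  rw [h3] at h2
  refine h1.trans ?_
  rw [div_mul_eq_mul_div, div_mul_eq_mul_div, le_div_iff₀ (by positivity)]
  linarith

theorem integrableOn_rpow_mul_one_add_rpow_mul_exp {p q η : ℝ} (hp : -1 < p) (hη : 0 < η) :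
    MeasureTheory.IntegrableOn (fun s : ℝ => s ^ p * (1 + s) ^ q * Real.exp (-(η * s)))
      (Set.Ioi 0) := by
  obtain ⟨C, hC, h⟩ := one_add_rpow_le_exp (q := q) (half_pos hη)
  have h1 := integrableOn_rpow_mul_exp_neg_mul_rpow (s := p) (p := 1) hp one_pos (half_pos hη)
  refine MeasureTheory.Integrable.mono' (h1.const_mul C) ?_ ?_
  · exact (by fun_prop : Measurable _).aestronglyMeasurable
  · filter_upwards [MeasureTheory.ae_restrict_mem measurableSet_Ioi] with s hs
    have hs : 0 < s := hs
    rw [Real.norm_of_nonneg (by positivity), Real.rpow_one]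
    have h2 : Real.exp (η / 2 * s) * Real.exp (-(η * s)) = Real.exp (-(η / 2) * s) := by
      rw [← Real.exp_add]
      ring_nf
    rw [← h2]
    calc s ^ p * (1 + s) ^ q * Real.exp (-(η * s))
        ≤ s ^ p * (C * Real.exp (η / 2 * s)) * Real.exp (-(η * s)) := by
          gcongr
          exact h s hs.le
      _ = _ := by ring

/-- The integrand `sʲ e^{-sY} s^{α-1} (1 + c s)^{-α-1/2}`. -/
noncomputable def laplaceIntegrand (j : ℕ) (α c Y : ℂ) (s : ℝ) : ℂ :=
  (s : ℂ) ^ j * Complex.exp (-(s * Y)) * ((s : ℂ) ^ (α - 1) * (1 + c * s) ^ (-α - 1 / 2))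

/-- The Laplace integral of `sʲ s^{α-1} (1 + c s)^{-α-1/2}`, convergent for `0 < Re α` and
`0 < Re Y`. -/
noncomputable def laplaceIntegral (j : ℕ) (α c Y : ℂ) : ℂ :=
  ∫ s in Set.Ioi (0 : ℝ), laplaceIntegrand j α c Y s

theorem measurable_laplaceIntegrand (j : ℕ) (α c Y : ℂ) :
    Measurable (laplaceIntegrand j α c Y) := by
  unfold laplaceIntegrand
  fun_prop

/-- A bound for `s^{α-1} (x + c s)^{-α-1/2}` uniform in `x` and `s`. -/
theorem exists_norm_kernel_le (α : ℂ) {c : ℂ} (hc : c ∈ Complex.slitPlane) :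
    ∃ δ C : ℝ, 0 < δ ∧ 0 ≤ C ∧ ∀ β : ℂ, β.re = -α.re - 1 / 2 → β.im = -α.im →
      ∀ c' ∈ Metric.ball c δ, c' ∈ Complex.slitPlane ∧ ∀ x s : ℝ, 0 ≤ x → 0 < s →
        ‖((x : ℂ) + c' * s) ^ β‖ ≤ C * (x + s) ^ (-α.re - 1 / 2) := by
  obtain ⟨κ, hκ, h⟩ := exists_le_norm_add_mul hc
  obtain ⟨ε, hε, hsub⟩ := Metric.isOpen_iff.1 Complex.isOpen_slitPlane c hc
  refine ⟨min ε (κ / 2), ((1 + (‖c‖ + κ / 2)) ^ (-α.re - 1 / 2) + (κ / 2) ^ (-α.re - 1 / 2)) *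
    Real.exp (Real.pi * |-α.im|), by positivity, by positivity, fun β hβ hβ' c' hc' =>
    ⟨hsub (Metric.ball_subset_ball (min_le_left _ _) hc'), fun x s hx hs => ?_⟩⟩
  have hd : ‖c' - c‖ ≤ κ / 2 := by
    rw [← dist_eq_norm]
    exact (Metric.mem_ball.1 hc').le.trans (min_le_right _ _)
  have hlow : κ / 2 * (x + s) ≤ ‖(x : ℂ) + c' * s‖ := by
    have h1 := h x s hx hs.le
    have h2 : (x : ℂ) + c * s = ((x : ℂ) + c' * s) - (c' - c) * s := by ring
    have h3 := norm_sub_le ((x : ℂ) + c' * s) ((c' - c) * s)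
    rw [← h2, norm_mul, Complex.norm_real, Real.norm_of_nonneg hs.le] at h3
    nlinarith
  have hup : ‖(x : ℂ) + c' * s‖ ≤ (1 + (‖c‖ + κ / 2)) * (x + s) := by
    refine (norm_add_mul_le c' hx hs.le).trans ?_
    have : ‖c'‖ ≤ ‖c‖ + ‖c' - c‖ := by
      simpa using norm_add_le c (c' - c)
    gcongr
    linarith
  have := norm_cpow_le_of_norm_bounds (β := β) (by positivity) (by positivity) hlow hup
  rwa [hβ, hβ'] at this

theorem exists_norm_laplaceIntegrand_le (j : ℕ) (α : ℂ) {c : ℂ} (hc : c ∈ Complex.slitPlane) :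
    ∃ δ C : ℝ, 0 < δ ∧ 0 ≤ C ∧ ∀ c' ∈ Metric.ball c δ, c' ∈ Complex.slitPlane ∧
      ∀ (Y : ℂ) (s : ℝ), 0 < s → ‖laplaceIntegrand j α c' Y s‖ ≤
        C * (s ^ (j + α.re - 1) * (1 + s) ^ (-α.re - 1 / 2) * Real.exp (-(Y.re * s))) := by
  obtain ⟨δ, C, hδ, hC, h⟩ := exists_norm_kernel_le α hc
  refine ⟨δ, C, hδ, hC, fun c' hc' => ⟨(h (-α - 1 / 2) (by simp) (by simp) c' hc').1,
    fun Y s hs => ?_⟩⟩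
  have h1 := (h (-α - 1 / 2) (by simp) (by simp) c' hc').2 1 s zero_le_one hs
  rw [laplaceIntegrand, norm_mul, norm_mul, norm_mul, norm_pow, Complex.norm_real,
    Real.norm_of_nonneg hs.le, Complex.norm_exp, Complex.norm_cpow_eq_rpow_re_of_pos hs]
  have h2 : s ^ (j + α.re - 1) = s ^ j * s ^ (α - 1).re := by
    rw [← Real.rpow_natCast, ← Real.rpow_add hs]
    congr 1
    simp
    ring
  have h3 : (-((s : ℂ) * Y)).re = -(Y.re * s) := by
    simp [mul_comm]
  rw [h2, h3]
  push_cast at h1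
  calc s ^ j * Real.exp (-(Y.re * s)) * (s ^ (α - 1).re * ‖(1 + c' * s) ^ (-α - 1 / 2)‖)
      ≤ s ^ j * Real.exp (-(Y.re * s)) * (s ^ (α - 1).re * (C * (1 + s) ^ (-α.re - 1 / 2))) := by
        gcongr
    _ = _ := by ring

theorem integrableOn_laplaceIntegrand {α c Y : ℂ} (j : ℕ) (hα : 0 < α.re) (hc : c ∈ Complex.slitPlane)
    (hY : 0 < Y.re) : MeasureTheory.IntegrableOn (laplaceIntegrand j α c Y) (Set.Ioi 0) := by
  obtain ⟨δ, C, hδ, hC, h⟩ := exists_norm_laplaceIntegrand_le j α hc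
  refine MeasureTheory.Integrable.mono'
    ((integrableOn_rpow_mul_one_add_rpow_mul_exp (p := j + α.re - 1) (q := -α.re - 1 / 2)
      (by linarith [(Nat.cast_nonneg j : (0 : ℝ) ≤ j)]) hY).const_mul C)
    (measurable_laplaceIntegrand _ _ _ _).aestronglyMeasurable ?_
  filter_upwards [MeasureTheory.ae_restrict_mem measurableSet_Ioi] with s hs
  exact (h c (Metric.mem_ball_self hδ)).2 Y s hs

theorem hasDerivAt_laplaceIntegral {α c Y : ℂ} (j : ℕ) (hα : 0 < α.re) (hc : c ∈ Complex.slitPlane)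
    (hY : 0 < Y.re) :
    HasDerivAt (laplaceIntegral j α c) (-laplaceIntegral (j + 1) α c Y) Y := by
  obtain ⟨δ, C, hδ, hC, h⟩ := exists_norm_laplaceIntegrand_le j α hc
  have key := hasDerivAt_integral_of_differentiableOn
    (μ := MeasureTheory.volume.restrict (Set.Ioi 0)) (F := laplaceIntegrand j α c)
    (F' := fun s => -laplaceIntegrand (j + 1) α c Y s) (w₀ := Y) (half_pos hY)
    (bound := fun s => C * (s ^ (j + α.re - 1) * (1 + s) ^ (-α.re - 1 / 2) *
      Real.exp (-(Y.re / 2 * s))))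
    (fun w _ => (measurable_laplaceIntegrand _ _ _ _).aestronglyMeasurable)
    (Eventually.of_forall fun s => by
      unfold laplaceIntegrand
      fun_prop)
    (by
      filter_upwards [MeasureTheory.ae_restrict_mem measurableSet_Ioi] with s hs w hw
      have hs : 0 < s := hs
      have hw' : Y.re / 2 ≤ w.re := by
        rw [Metric.mem_ball, dist_eq_norm] at hw
        have := (abs_le.1 (Complex.abs_re_le_norm (w - Y))).1
        simp at this
        linarith
      refine ((h c (Metric.mem_ball_self hδ)).2 w s hs).trans ?_
      gcongr)
    ((integrableOn_rpow_mul_one_add_rpow_mul_exp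
      (by linarith [(Nat.cast_nonneg j : (0 : ℝ) ≤ j)]) (half_pos hY)).const_mul C)
    (Eventually.of_forall fun s => by
      have h1 : HasDerivAt (fun w : ℂ => -((s : ℂ) * w)) (-s) Y := by
        convert! ((hasDerivAt_id Y).const_mul (s : ℂ)).neg using 1
        simp
      convert! (h1.cexp.const_mul ((s : ℂ) ^ j)).mul_const
        ((s : ℂ) ^ (α - 1) * (1 + c * s) ^ (-α - 1 / 2)) using 1
      rw [laplaceIntegrand, pow_succ]
      ring)
  have h2 := key.2
  rw [MeasureTheory.integral_neg] at h2
  exact h2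

/-- The confluent hypergeometric equation for the Laplace integrals, obtained by integrating the
derivative of `e^{-sY} s^α (1 + c s)^{1/2-α}`. -/
theorem laplaceIntegral_ode {α c Y : ℂ} (hα : 0 < α.re) (hc : c ∈ Complex.slitPlane) (hY : 0 < Y.re) :
    α * laplaceIntegral 0 α c Y + (c / 2 - Y) * laplaceIntegral 1 α c Y -
      c * Y * laplaceIntegral 2 α c Y = 0 := by
  have hi := fun j => integrableOn_laplaceIntegrand j hα hc hY
  have hα0 : α ≠ 0 := fun h => by simp [h] at hα
  have hsplit : ∀ s : ℝ, 0 < s → (s : ℂ) ^ α = s * (s : ℂ) ^ (α - 1) := fun s hs => by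
    rw [Complex.cpow_sub _ _ (by exact_mod_cast hs.ne'), Complex.cpow_one]
    have : (s : ℂ) ≠ 0 := by exact_mod_cast hs.ne'
    field_simp
  have hsplit' : ∀ s : ℝ, 0 < s → (1 + c * s) ^ (1 / 2 - α) =
      (1 + c * s) * (1 + c * s) ^ (-α - 1 / 2) := fun s hs => by
    have h1 : 1 + c * s ≠ 0 := Complex.slitPlane_ne_zero (one_add_mul_mem_slitPlane hc hs.le)
    rw [show 1 / 2 - α = 1 + (-α - 1 / 2) by ring, Complex.cpow_add _ _ h1, Complex.cpow_one]
  set f : ℝ → ℂ := fun s => Complex.exp (-(s * Y)) * (s : ℂ) ^ α * (1 + c * s) ^ (1 / 2 - α)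
    with hf
  set f' : ℝ → ℂ := fun s => α * laplaceIntegrand 0 α c Y s +
    (c / 2 - Y) * laplaceIntegrand 1 α c Y s - c * Y * laplaceIntegrand 2 α c Y s with hf'
  have hderiv : ∀ s ∈ Set.Ioi (0 : ℝ), HasDerivAt f (f' s) s := by
    intro s hs
    have hs : 0 < s := hs
    have h1 : 1 + c * s ∈ Complex.slitPlane := one_add_mul_mem_slitPlane hc hs.le
    have hs' : (s : ℂ) ∈ Complex.slitPlane := Complex.ofReal_mem_slitPlane.2 hs
    have d1 : HasDerivAt (fun w : ℂ => Complex.exp (-(w * Y)))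
        (Complex.exp (-(s * Y)) * (-(1 * Y))) (s : ℂ) :=
      ((hasDerivAt_id (s : ℂ)).mul_const Y).neg.cexp
    have d2 : HasDerivAt (fun w : ℂ => w ^ α) (α * (s : ℂ) ^ (α - 1) * 1) (s : ℂ) :=
      (hasDerivAt_id (s : ℂ)).cpow_const hs'
    have d3 : HasDerivAt (fun w : ℂ => (1 + c * w) ^ (1 / 2 - α))
        ((1 / 2 - α) * (1 + c * s) ^ (1 / 2 - α - 1) * (c * 1)) (s : ℂ) :=
      (((hasDerivAt_id (s : ℂ)).const_mul c).const_add 1).cpow_const h1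
    convert! ((d1.mul d2).mul d3).comp_ofReal using 1
    simp only [hf', laplaceIntegrand, Pi.mul_apply]
    rw [show 1 / 2 - α - 1 = -α - 1 / 2 by ring, hsplit s hs, hsplit' s hs]
    ring
  have hf'int : MeasureTheory.IntegrableOn f' (Set.Ioi 0) :=
    (((hi 0).const_mul α).add ((hi 1).const_mul (c / 2 - Y))).sub ((hi 2).const_mul (c * Y))
  have hfint : MeasureTheory.IntegrableOn f (Set.Ioi 0) := by
    refine ((hi 1).add ((hi 2).const_mul c)).congr_fun (fun s hs => ?_) measurableSet_Ioi
    simp only [hf, laplaceIntegrand, Pi.add_apply]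
    rw [hsplit s hs, hsplit' s hs]
    ring
  have hlim := MeasureTheory.tendsto_zero_of_hasDerivAt_of_integrableOn_Ioi hderiv hf'int hfint
  have hcont : ContinuousWithinAt f (Set.Ici 0) 0 := by
    refine ContinuousAt.continuousWithinAt ?_
    refine ContinuousAt.mul (ContinuousAt.mul (by fun_prop) ?_) ?_
    · exact (Complex.continuousAt_ofReal_cpow_const 0 α (Or.inl hα))
    · exact ContinuousAt.cpow (by fun_prop) continuousAt_const (by simp)
  have h := MeasureTheory.integral_Ioi_of_hasDerivAt_of_tendsto hcont hderiv hf'int hlim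
  have hf0 : f 0 = 0 := by simp [hf, hα0]
  rw [hf0, sub_zero] at h
  rw [← h, hf', MeasureTheory.integral_sub, MeasureTheory.integral_add,
    MeasureTheory.integral_const_mul, MeasureTheory.integral_const_mul,
    MeasureTheory.integral_const_mul]
  · rfl
  · exact (hi 0).const_mul α
  · exact (hi 1).const_mul _
  · exact ((hi 0).const_mul α).add ((hi 1).const_mul _)
  · exact (hi 2).const_mul _

/-! ### The Laplace integral at the origin as a Beta integral -/

theorem integrableOn_rpow_mul_one_add_rpow {p : ℝ} (hp : 0 < p) :
    MeasureTheory.IntegrableOn (fun s : ℝ => s ^ (p - 1) * (1 + s) ^ (-p - 1 / 2))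
      (Set.Ioi 0) := by
  have hmeas : Measurable (fun s : ℝ => s ^ (p - 1) * (1 + s) ^ (-p - 1 / 2)) := by fun_prop
  rw [← Set.Ioc_union_Ioi_eq_Ioi zero_le_one]
  refine MeasureTheory.IntegrableOn.union ?_ ?_
  · have h := (intervalIntegral.intervalIntegrable_rpow' (a := 0) (b := 1) (r := p - 1)
      (by linarith))
    rw [intervalIntegrable_iff_integrableOn_Ioc_of_le zero_le_one] at h
    refine MeasureTheory.Integrable.mono' h hmeas.aestronglyMeasurable ?_
    filter_upwards [MeasureTheory.ae_restrict_mem measurableSet_Ioc] with s hs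
    have hs0 : 0 < s := hs.1
    rw [Real.norm_of_nonneg (by positivity)]
    exact mul_le_of_le_one_right (by positivity)
      (Real.rpow_le_one_of_one_le_of_nonpos (by linarith) (by linarith))
  · have h := integrableOn_Ioi_rpow_of_lt (a := -3 / 2) (by norm_num) one_pos
    refine MeasureTheory.Integrable.mono' h hmeas.aestronglyMeasurable ?_
    filter_upwards [MeasureTheory.ae_restrict_mem measurableSet_Ioi] with s hs
    have hs0 : 0 < s := one_pos.trans hs
    rw [Real.norm_of_nonneg (by positivity)]
    have h1 : (1 + s) ^ (-p - 1 / 2) ≤ s ^ (-p - 1 / 2) :=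
      Real.rpow_le_rpow_of_nonpos hs0 (by linarith) (by linarith)
    calc s ^ (p - 1) * (1 + s) ^ (-p - 1 / 2) ≤ s ^ (p - 1) * s ^ (-p - 1 / 2) := by gcongr
      _ = s ^ (-3 / 2 : ℝ) := by
        rw [← Real.rpow_add hs0]
        congr 1
        ring

/-- The Laplace integral extends continuously to `Y = 0` along rays, although
`0 < Re Y` fails there. -/
theorem tendsto_laplaceIntegral_zero {α c Y : ℂ} (hα : 0 < α.re) (hc : c ∈ Complex.slitPlane)
    (hY : 0 < Y.re) :
    Tendsto (fun t : ℝ => laplaceIntegral 0 α c ((t : ℂ) ^ 2 * Y)) (𝓝[>] 0)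
      (𝓝 (laplaceIntegral 0 α c 0)) := by
  obtain ⟨δ, C, hδ, hC, h⟩ := exists_norm_laplaceIntegrand_le 0 α hc
  refine MeasureTheory.tendsto_integral_filter_of_dominated_convergence
    (fun s => C * (s ^ (α.re - 1) * (1 + s) ^ (-α.re - 1 / 2)))
    (Eventually.of_forall fun t => (measurable_laplaceIntegrand _ _ _ _).aestronglyMeasurable)
    ?_ ((integrableOn_rpow_mul_one_add_rpow hα).const_mul C) ?_
  · refine Eventually.of_forall fun t => ?_
    filter_upwards [MeasureTheory.ae_restrict_mem measurableSet_Ioi] with s hs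
    have hs : 0 < s := hs
    refine ((h c (Metric.mem_ball_self hδ)).2 _ s hs).trans ?_
    have h1 : Real.exp (-(((t : ℂ) ^ 2 * Y).re * s)) ≤ 1 := by
      rw [← Complex.ofReal_pow, Complex.re_ofReal_mul, Real.exp_le_one_iff]
      have : 0 ≤ t ^ 2 * Y.re * s := by positivity
      linarith
    rw [Nat.cast_zero, zero_add]
    exact mul_le_mul_of_nonneg_left (mul_le_of_le_one_right (by positivity) h1) hC
  · refine Eventually.of_forall fun s => ?_
    have hcont : Continuous fun t : ℝ => laplaceIntegrand 0 α c ((t : ℂ) ^ 2 * Y) s := by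
      unfold laplaceIntegrand
      fun_prop
    simpa using (hcont.tendsto 0).mono_left nhdsWithin_le_nhds

/-- The Beta integral over the half-line. -/
theorem laplaceIntegral_one_zero {α : ℂ} (hα : 0 < α.re) :
    laplaceIntegral 0 α 1 0 = Complex.Gamma α * Complex.Gamma (1 / 2) / Complex.Gamma (α + 1 / 2) := by
  have himg : (fun s : ℝ => s / (1 + s)) '' Set.Ioi 0 = Set.Ioo 0 1 := by
    ext x
    constructor
    · rintro ⟨s, hs, rfl⟩
      have hs : 0 < s := hs
      exact ⟨by positivity, by rw [div_lt_one (by positivity)]; linarith⟩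
    · rintro ⟨h0, h1⟩
      have h2 : 1 - x ≠ 0 := by linarith
      refine ⟨x / (1 - x), div_pos h0 (by linarith), ?_⟩
      simp only
      field_simp
      ring
  have hinj : Set.InjOn (fun s : ℝ => s / (1 + s)) (Set.Ioi 0) := by
    intro s hs t ht hst
    have hs : 0 < s := hs
    have ht : 0 < t := ht
    simp only at hst
    rw [div_eq_div_iff (by positivity) (by positivity)] at hst
    linarith
  have hder : ∀ s ∈ Set.Ioi (0 : ℝ), HasDerivWithinAt (fun s : ℝ => s / (1 + s))
      (1 / (1 + s) ^ 2) (Set.Ioi 0) s := by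
    intro s hs
    have hs : 0 < s := hs
    have := (hasDerivAt_id s).div ((hasDerivAt_id s).const_add 1) (by simp only [id]; positivity)
    convert! this.hasDerivWithinAt using 1
    simp
  have hsub := MeasureTheory.integral_image_eq_integral_abs_deriv_smul measurableSet_Ioi hder hinj
    (fun x : ℝ => (x : ℂ) ^ (α - 1) * (1 - (x : ℂ)) ^ ((1 / 2 : ℂ) - 1))
  have hbeta : Complex.betaIntegral α (1 / 2) = laplaceIntegral 0 α 1 0 := by
    rw [Complex.betaIntegral, intervalIntegral.integral_of_le zero_le_one,
      ← MeasureTheory.integral_Ioc_eq_integral_Ioo.symm, ← himg, hsub]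
    refine MeasureTheory.setIntegral_congr_fun measurableSet_Ioi fun s hs => ?_
    have hs : 0 < s := hs
    have h1 : 0 < 1 + s := by positivity
    have h1' : (1 : ℂ) + s ≠ 0 := by exact_mod_cast h1.ne'
    have h1'' : (1 : ℂ) + s = ((1 + s : ℝ) : ℂ) := by push_cast; ring
    have e1 : (1 : ℂ) - ((s / (1 + s) : ℝ) : ℂ) = ((1 + s : ℝ) : ℂ)⁻¹ := by
      push_cast
      field_simp
      ring
    have e2 : ((s / (1 + s) : ℝ) : ℂ) = (s : ℂ) * ((1 + s : ℝ) : ℂ)⁻¹ := by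
      push_cast
      field_simp
    have e3 : (((1 + s : ℝ) : ℂ)⁻¹) = (((1 + s)⁻¹ : ℝ) : ℂ) := by push_cast; ring
    have harg : ((1 + s : ℝ) : ℂ).arg ≠ Real.pi := by
      rw [Complex.arg_ofReal_of_nonneg h1.le]
      exact Real.pi_pos.ne
    simp only [laplaceIntegrand, Complex.real_smul, pow_zero, one_mul, mul_zero, neg_zero,
      Complex.exp_zero]
    rw [e1, e2, e3, Complex.mul_cpow_ofReal_nonneg hs.le (by positivity), ← e3,
      Complex.inv_cpow _ _ harg, Complex.inv_cpow _ _ harg, h1'',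
      abs_of_pos (by positivity), ← Complex.cpow_neg, ← Complex.cpow_neg]
    have h2 : ((1 / (1 + s) ^ 2 : ℝ) : ℂ) = ((1 + s : ℝ) : ℂ) ^ (-2 : ℂ) := by
      rw [Complex.cpow_neg]
      push_cast
      norm_num [Complex.cpow_ofNat]
    have h3 : ((1 + s : ℝ) : ℂ) ≠ 0 := by exact_mod_cast h1.ne'
    rw [h2, show -α - 1 / 2 = -2 + (-(α - 1) + -(1 / 2 - 1)) by ring, Complex.cpow_add _ _ h3,
      Complex.cpow_add _ _ h3]
    ring
  have hG := Complex.Gamma_mul_Gamma_eq_betaIntegral hα (t := 1 / 2) (by norm_num)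
  rw [hG, hbeta, mul_div_cancel_left₀]
  exact Complex.Gamma_ne_zero_of_re_pos (by simp; linarith)

/-- The derivative in `c` of the kernel integral: `α I + c I' = 0`, because the left-hand side is
the integral of the derivative of `s^α (1 + c s)^{-α-1/2}`. -/
theorem exists_hasDerivAt_laplaceIntegral_zero {α c : ℂ} (hα : 0 < α.re)
    (hc : c ∈ Complex.slitPlane) :
    ∃ D : ℂ, HasDerivAt (fun c => laplaceIntegral 0 α c 0) D c ∧
      α * laplaceIntegral 0 α c 0 + c * D = 0 := by
  obtain ⟨δ, C, hδ, hC, h⟩ := exists_norm_laplaceIntegrand_le 0 α hc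
  obtain ⟨δ', C', hδ', hC', hk⟩ := exists_norm_kernel_le α hc
  have hα0 : α ≠ 0 := fun h => by simp [h] at hα
  set F' : ℝ → ℂ := fun s =>
    (s : ℂ) ^ (α - 1) * ((-α - 1 / 2) * (1 + c * s) ^ (-α - 1 / 2 - 1) * s) with hF'
  have hbd : ∀ c' ∈ Metric.ball c δ, ∀ s : ℝ, 0 < s → ‖laplaceIntegrand 0 α c' 0 s‖ ≤
      C * (s ^ (α.re - 1) * (1 + s) ^ (-α.re - 1 / 2)) := fun c' hc' s hs => by
    simpa using (h c' hc').2 0 s hs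
  have hbi := (integrableOn_rpow_mul_one_add_rpow hα).const_mul C
  have key := hasDerivAt_integral_of_differentiableOn
    (μ := MeasureTheory.volume.restrict (Set.Ioi 0)) (F := fun c => laplaceIntegrand 0 α c 0)
    (F' := F') (w₀ := c) hδ
    (fun w _ => (measurable_laplaceIntegrand _ _ _ _).aestronglyMeasurable)
    (by
      filter_upwards [MeasureTheory.ae_restrict_mem measurableSet_Ioi] with s hs w hw
      have hs : 0 < s := hs
      unfold laplaceIntegrand
      refine DifferentiableAt.differentiableWithinAt ?_
      refine DifferentiableAt.const_mul (DifferentiableAt.const_mul ?_ _) _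
      exact DifferentiableAt.cpow (by fun_prop) (by fun_prop)
        (one_add_mul_mem_slitPlane (h w hw).1 hs.le))
    (by
      filter_upwards [MeasureTheory.ae_restrict_mem measurableSet_Ioi] with s hs w hw
      exact hbd w hw s hs)
    hbi
    (by
      filter_upwards [MeasureTheory.ae_restrict_mem measurableSet_Ioi] with s hs
      have hs : 0 < s := hs
      have d3 : HasDerivAt (fun w : ℂ => (1 + w * s) ^ (-α - 1 / 2))
          ((-α - 1 / 2) * (1 + c * s) ^ (-α - 1 / 2 - 1) * (1 * s)) c :=
        (((hasDerivAt_id c).mul_const (s : ℂ)).const_add 1).cpow_const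
          (one_add_mul_mem_slitPlane hc hs.le)
      have := (d3.const_mul ((s : ℂ) ^ (α - 1))).const_mul
        ((s : ℂ) ^ 0 * Complex.exp (-(s * 0)))
      convert! this using 1
      simp [hF'])
  refine ⟨_, key.2, ?_⟩
  have hi : MeasureTheory.IntegrableOn (laplaceIntegrand 0 α c 0) (Set.Ioi 0) := by
    refine MeasureTheory.Integrable.mono' hbi
      (measurable_laplaceIntegrand _ _ _ _).aestronglyMeasurable ?_
    filter_upwards [MeasureTheory.ae_restrict_mem measurableSet_Ioi] with s hs
    exact hbd c (Metric.mem_ball_self hδ) s hs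
  set f : ℝ → ℂ := fun s => (s : ℂ) ^ α * (1 + c * s) ^ (-α - 1 / 2) with hf
  have hderiv : ∀ s ∈ Set.Ioi (0 : ℝ),
      HasDerivAt f (α * laplaceIntegrand 0 α c 0 s + c * F' s) s := by
    intro s hs
    have hs : 0 < s := hs
    have h1 : 1 + c * s ∈ Complex.slitPlane := one_add_mul_mem_slitPlane hc hs.le
    have d2 : HasDerivAt (fun w : ℂ => w ^ α) (α * (s : ℂ) ^ (α - 1) * 1) (s : ℂ) :=
      (hasDerivAt_id (s : ℂ)).cpow_const (Complex.ofReal_mem_slitPlane.2 hs)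
    have d3 : HasDerivAt (fun w : ℂ => (1 + c * w) ^ (-α - 1 / 2))
        ((-α - 1 / 2) * (1 + c * s) ^ (-α - 1 / 2 - 1) * (c * 1)) (s : ℂ) :=
      (((hasDerivAt_id (s : ℂ)).const_mul c).const_add 1).cpow_const h1
    convert! (d2.mul d3).comp_ofReal using 1
    have hs' : (s : ℂ) ≠ 0 := by exact_mod_cast hs.ne'
    simp only [hF', laplaceIntegrand, pow_zero, mul_zero, neg_zero, Complex.exp_zero, one_mul]
    rw [Complex.cpow_sub _ _ hs', Complex.cpow_one]
    field_simp
  have hlim : Tendsto f atTop (𝓝 0) := by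
    have h1 : Tendsto (fun s : ℝ => C' * (1 + s) ^ (-(1 / 2) : ℝ)) atTop (𝓝 0) := by
      have := (tendsto_rpow_neg_atTop (y := 1 / 2) (by norm_num)).comp
        (tendsto_atTop_add_const_left atTop (1 : ℝ) tendsto_id)
      simpa using this.const_mul C'
    refine squeeze_zero_norm' ?_ h1
    filter_upwards [Ioi_mem_atTop 0] with s hs
    have hs : 0 < s := hs
    have h2 := (hk (-α - 1 / 2) (by simp) (by simp) c (Metric.mem_ball_self hδ')).2 1 s
      zero_le_one hs
    have h3 : s ^ α.re ≤ (1 + s) ^ α.re := Real.rpow_le_rpow hs.le (by linarith) hα.le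
    push_cast at h2
    rw [hf, norm_mul, Complex.norm_cpow_eq_rpow_re_of_pos hs]
    calc s ^ α.re * ‖(1 + c * s) ^ (-α - 1 / 2)‖
        ≤ (1 + s) ^ α.re * (C' * (1 + s) ^ (-α.re - 1 / 2)) := by gcongr
      _ = C' * ((1 + s) ^ α.re * (1 + s) ^ (-α.re - 1 / 2)) := by ring
      _ = _ := by
        rw [← Real.rpow_add (by positivity)]
        congr 2
        ring
  have hcont : ContinuousWithinAt f (Set.Ici 0) 0 := by
    refine ContinuousAt.continuousWithinAt ?_
    refine ContinuousAt.mul ?_ ?_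
    · exact (Complex.continuousAt_ofReal_cpow_const 0 α (Or.inl hα))
    · exact ContinuousAt.cpow (by fun_prop) continuousAt_const (by simp)
  have hfin := MeasureTheory.integral_Ioi_of_hasDerivAt_of_tendsto hcont hderiv
    ((hi.const_mul α).add (key.1.const_mul c)) hlim
  have hf0 : f 0 = 0 := by simp [hf, hα0]
  rw [hf0, sub_zero, MeasureTheory.integral_add (hi.const_mul α) (key.1.const_mul c),
    MeasureTheory.integral_const_mul, MeasureTheory.integral_const_mul] at hfin
  exact hfin

theorem isPreconnected_slitPlane : IsPreconnected Complex.slitPlane :=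
  (Complex.starConvex_one_slitPlane.isPathConnected
    Complex.one_mem_slitPlane).isConnected.isPreconnected

/-- The general case follows from `c = 1`, because `c^α` times the integral has derivative `0` in `c` on
the slit plane. -/
theorem laplaceIntegral_zero {α c : ℂ} (hα : 0 < α.re) (hc : c ∈ Complex.slitPlane) :
    laplaceIntegral 0 α c 0 = c ^ (-α) * (Complex.Gamma α * Complex.Gamma (1 / 2) /
      Complex.Gamma (α + 1 / 2)) := by
  have hd : ∀ c ∈ Complex.slitPlane,
      HasDerivAt (fun c : ℂ => c ^ α * laplaceIntegral 0 α c 0) 0 c := by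
    intro c hc
    obtain ⟨D, hD, hD0⟩ := exists_hasDerivAt_laplaceIntegral_zero hα hc
    have hc0 := Complex.slitPlane_ne_zero hc
    convert! ((hasDerivAt_id c).cpow_const (c := α) hc).mul hD using 1
    simp only [id]
    rw [Complex.cpow_sub _ _ hc0, Complex.cpow_one]
    field_simp
    linear_combination (-c ^ α) * hD0
  have h := Complex.isOpen_slitPlane.is_const_of_deriv_eq_zero isPreconnected_slitPlane
    (fun x hx => (hd x hx).differentiableAt.differentiableWithinAt)
    (fun x hx => (hd x hx).deriv) hc Complex.one_mem_slitPlane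
  simp only [Complex.one_cpow, one_mul] at h
  rw [← laplaceIntegral_one_zero hα, ← h, ← mul_assoc, ← Complex.cpow_add _ _
    (Complex.slitPlane_ne_zero hc)]
  simp

/-! ### The Laplace integral as a parabolic cylinder function -/

theorem ofReal_mul_cpow {T : ℝ} (hT : 0 < T) {z : ℂ} (hz : z ≠ 0) (β : ℂ) :
    ((T : ℂ) * z) ^ β = (T : ℂ) ^ β * z ^ β := by
  have hT' : (T : ℂ) ≠ 0 := by exact_mod_cast hT.ne'
  rw [Complex.cpow_def_of_ne_zero (mul_ne_zero hT' hz), Complex.cpow_def_of_ne_zero hT',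
    Complex.cpow_def_of_ne_zero hz, Complex.log_ofReal_mul hT hz, ← Complex.exp_add,
    ← Complex.ofReal_log hT.le]
  ring_nf

/-- The substitution `s = q / t²` turns `t` times the first moment into an integral that still converges
at `t = 0`. -/
theorem mul_laplaceIntegral_one_sq {α c Y : ℂ} (hc : c ∈ Complex.slitPlane) {t : ℝ} (ht : 0 < t) :
    (t : ℂ) * laplaceIntegral 1 α c ((t : ℂ) ^ 2 * Y) = ∫ q in Set.Ioi (0 : ℝ),
      q * (q : ℂ) ^ (α - 1) * Complex.exp (-(q * Y)) *
        (((t ^ 2 : ℝ) : ℂ) + c * q) ^ (-α - 1 / 2) := by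
  have hT : 0 < t ^ 2 := by positivity
  have ht0 : (t : ℂ) ≠ 0 := by exact_mod_cast ht.ne'
  have hT0 : ((t ^ 2 : ℝ) : ℂ) ≠ 0 := by exact_mod_cast hT.ne'
  have hscale := MeasureTheory.integral_comp_mul_left_Ioi (fun q : ℝ =>
    q * (q : ℂ) ^ (α - 1) * Complex.exp (-(q * Y)) *
      (((t ^ 2 : ℝ) : ℂ) + c * q) ^ (-α - 1 / 2)) 0 hT
  rw [mul_zero] at hscale
  have hpow : ((t ^ 2 : ℝ) : ℂ) * (((t ^ 2 : ℝ) : ℂ) ^ (α - 1) *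
      ((t ^ 2 : ℝ) : ℂ) ^ (-α - 1 / 2)) = (t : ℂ)⁻¹ := by
    rw [← Complex.cpow_add _ _ hT0]
    nth_rewrite 1 [← Complex.cpow_one ((t ^ 2 : ℝ) : ℂ)]
    rw [← Complex.cpow_add _ _ hT0, show 1 + (α - 1 + (-α - 1 / 2)) = ((-(1 / 2) : ℝ) : ℂ) by
      push_cast; ring, ← Complex.ofReal_cpow hT.le, Real.rpow_neg hT.le, ← Real.sqrt_eq_rpow,
      Real.sqrt_sq ht.le]
    push_cast
    rfl
  have hcongr : ∫ s in Set.Ioi (0 : ℝ), (((t ^ 2 * s : ℝ) : ℂ) * ((t ^ 2 * s : ℝ) : ℂ) ^ (α - 1) *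
      Complex.exp (-(((t ^ 2 * s : ℝ) : ℂ) * Y)) *
      (((t ^ 2 : ℝ) : ℂ) + c * ((t ^ 2 * s : ℝ) : ℂ)) ^ (-α - 1 / 2)) =
      ∫ s in Set.Ioi (0 : ℝ), (t : ℂ)⁻¹ * laplaceIntegrand 1 α c ((t : ℂ) ^ 2 * Y) s := by
    refine MeasureTheory.setIntegral_congr_fun measurableSet_Ioi fun s hs => ?_
    have hs : 0 < s := hs
    have h1 : 1 + c * (s : ℂ) ≠ 0 :=
      Complex.slitPlane_ne_zero (one_add_mul_mem_slitPlane hc hs.le)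
    have h2 : ((t ^ 2 : ℝ) : ℂ) + c * ((t ^ 2 * s : ℝ) : ℂ) = ((t ^ 2 : ℝ) : ℂ) * (1 + c * s) := by
      push_cast
      ring
    simp only [laplaceIntegrand]
    rw [h2, ofReal_mul_cpow hT h1, Complex.ofReal_mul (t ^ 2) s,
      Complex.mul_cpow_ofReal_nonneg hT.le hs.le, ← hpow]
    push_cast
    ring_nf
  rw [hcongr, MeasureTheory.integral_const_mul] at hscale
  have hcast : ((t ^ 2)⁻¹ : ℝ) • (∫ q in Set.Ioi (0 : ℝ),
      q * (q : ℂ) ^ (α - 1) * Complex.exp (-(q * Y)) *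
        (((t ^ 2 : ℝ) : ℂ) + c * q) ^ (-α - 1 / 2)) = ((t : ℂ) ^ 2)⁻¹ * ∫ q in Set.Ioi (0 : ℝ),
      q * (q : ℂ) ^ (α - 1) * Complex.exp (-(q * Y)) *
        (((t ^ 2 : ℝ) : ℂ) + c * q) ^ (-α - 1 / 2) := by
    rw [Complex.real_smul]
    push_cast
    rfl
  rw [hcast] at hscale
  refine mul_left_cancel₀ (inv_ne_zero (pow_ne_zero 2 ht0)) (Eq.trans ?_ hscale)
  rw [← mul_assoc]
  congr 1
  field_simp

/-- A Gamma integral with complex rate, reduced to the Gaussian integral by `q = x²`. -/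
theorem integral_cpow_neg_half_mul_exp {Y : ℂ} (hY : 0 < Y.re) :
    ∫ q in Set.Ioi (0 : ℝ), (q : ℂ) ^ (-(1 / 2) : ℂ) * Complex.exp (-(q * Y)) =
      (1 / Y) ^ (1 / 2 : ℂ) * Complex.Gamma (1 / 2) := by
  have hY0 : Y ≠ 0 := fun h => by simp [h] at hY
  rw [← MeasureTheory.integral_comp_rpow_Ioi _ (two_ne_zero : (2 : ℝ) ≠ 0)]
  have h : ∀ x ∈ Set.Ioi (0 : ℝ), (|(2 : ℝ)| * x ^ ((2 : ℝ) - 1)) •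
      (((x ^ (2 : ℝ) : ℝ) : ℂ) ^ (-(1 / 2) : ℂ) * Complex.exp (-(((x ^ (2 : ℝ) : ℝ) : ℂ) * Y))) =
      2 * Complex.exp (-Y * (x : ℂ) ^ 2) := by
    intro x hx
    have hx : 0 < x := hx
    have hx0 : (x : ℂ) ≠ 0 := by exact_mod_cast hx.ne'
    have h1 : ((x ^ (2 : ℝ) : ℝ) : ℂ) ^ (-(1 / 2) : ℂ) = (x : ℂ)⁻¹ := by
      rw [show (-(1 / 2) : ℂ) = ((-(1 / 2) : ℝ) : ℂ) by push_cast; ring,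
        ← Complex.ofReal_cpow (by positivity), ← Real.rpow_mul hx.le]
      norm_num [Real.rpow_neg_one]
    rw [h1, Complex.real_smul, abs_of_pos two_pos, show (2 : ℝ) - 1 = 1 by norm_num, Real.rpow_one,
      Real.rpow_two]
    push_cast
    field_simp
  rw [MeasureTheory.setIntegral_congr_fun measurableSet_Ioi h, MeasureTheory.integral_const_mul,
    integral_gaussian_complex_Ioi hY, div_eq_mul_one_div (Real.pi : ℂ),
    ofReal_mul_cpow Real.pi_pos (one_div_ne_zero hY0), Complex.Gamma_one_half_eq]
  ring

/-- The first moment of the kernel diverges at `Y = 0`; its leading behaviour gives the derivative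
of the solution of Weber's equation at the origin. -/
theorem tendsto_mul_laplaceIntegral_one {α c Y : ℂ} (hα : 0 < α.re)
    (hc : c ∈ Complex.slitPlane) (hY : 0 < Y.re) :
    Tendsto (fun t : ℝ => (t : ℂ) * laplaceIntegral 1 α c ((t : ℂ) ^ 2 * Y)) (𝓝[>] 0)
      (𝓝 (c ^ (-α - 1 / 2) * ((1 / Y) ^ (1 / 2 : ℂ) * Complex.Gamma (1 / 2)))) := by
  obtain ⟨δ, C, hδ, hC, h⟩ := exists_norm_kernel_le α hc
  have hk := (h (-α - 1 / 2) (by simp) (by simp) c (Metric.mem_ball_self hδ)).2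
  have hval : c ^ (-α - 1 / 2) * ((1 / Y) ^ (1 / 2 : ℂ) * Complex.Gamma (1 / 2)) =
      ∫ q in Set.Ioi (0 : ℝ), (q : ℂ) * (q : ℂ) ^ (α - 1) * Complex.exp (-(q * Y)) *
        (c * q) ^ (-α - 1 / 2) := by
    rw [← integral_cpow_neg_half_mul_exp hY,
      ← MeasureTheory.integral_const_mul]
    refine MeasureTheory.setIntegral_congr_fun measurableSet_Ioi fun q hq => ?_
    have hq : 0 < q := hq
    have hq0 : (q : ℂ) ≠ 0 := by exact_mod_cast hq.ne'
    rw [mul_comm c, ofReal_mul_cpow hq (Complex.slitPlane_ne_zero hc),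
      show (-(1 / 2) : ℂ) = 1 + (α - 1) + (-α - 1 / 2) by ring, Complex.cpow_add _ _ hq0,
      Complex.cpow_add _ _ hq0, Complex.cpow_one]
    ring_nf
  have hev : (fun t : ℝ => ∫ q in Set.Ioi (0 : ℝ),
      q * (q : ℂ) ^ (α - 1) * Complex.exp (-(q * Y)) *
        (((t ^ 2 : ℝ) : ℂ) + c * q) ^ (-α - 1 / 2)) =ᶠ[𝓝[>] 0]
      (fun t : ℝ => (t : ℂ) * laplaceIntegral 1 α c ((t : ℂ) ^ 2 * Y)) := by
    filter_upwards [self_mem_nhdsWithin] with t ht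
    exact (mul_laplaceIntegral_one_sq hc ht).symm
  rw [hval]
  refine Tendsto.congr' hev ?_
  refine MeasureTheory.tendsto_integral_filter_of_dominated_convergence
    (fun q => C * (q ^ (-(1 / 2) : ℝ) * (1 + q) ^ (0 : ℝ) * Real.exp (-(Y.re * q))))
    (Eventually.of_forall fun t => ?_)
    ?_ ((integrableOn_rpow_mul_one_add_rpow_mul_exp (by norm_num) hY).const_mul C) ?_
  · exact (by fun_prop : Measurable _).aestronglyMeasurable
  · refine Eventually.of_forall fun t => ?_
    filter_upwards [MeasureTheory.ae_restrict_mem measurableSet_Ioi] with q hq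
    have hq : 0 < q := hq
    have h1 := hk (t ^ 2) q (by positivity) hq
    have h2 : (t ^ 2 + q) ^ (-α.re - 1 / 2) ≤ q ^ (-α.re - 1 / 2) :=
      Real.rpow_le_rpow_of_nonpos hq (by linarith [sq_nonneg t]) (by linarith)
    have h3 : (-((q : ℂ) * Y)).re = -(Y.re * q) := by simp [mul_comm]
    rw [norm_mul, norm_mul, norm_mul, Complex.norm_real, Real.norm_of_nonneg hq.le,
      Complex.norm_exp, h3, Complex.norm_cpow_eq_rpow_re_of_pos hq, Real.rpow_zero, mul_one]
    calc q * q ^ (α - 1).re * Real.exp (-(Y.re * q)) *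
          ‖(((t ^ 2 : ℝ) : ℂ) + c * q) ^ (-α - 1 / 2)‖
        ≤ q * q ^ (α - 1).re * Real.exp (-(Y.re * q)) * (C * q ^ (-α.re - 1 / 2)) := by
          gcongr
          exact h1.trans (by gcongr)
      _ = C * ((q ^ (1 : ℝ) * q ^ (α - 1).re * q ^ (-α.re - 1 / 2)) * Real.exp (-(Y.re * q))) := by
          rw [Real.rpow_one]
          ring
      _ = _ := by
          rw [← Real.rpow_add hq, ← Real.rpow_add hq]
          congr 3
          simp
          ring
  · filter_upwards [MeasureTheory.ae_restrict_mem measurableSet_Ioi] with q hq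
    have hq : 0 < q := hq
    have hs : c * (q : ℂ) ∈ Complex.slitPlane := by
      simpa using add_mul_mem_slitPlane hc le_rfl hq.le (by simpa using hq)
    have hcont : ContinuousAt (fun t : ℝ => (((t ^ 2 : ℝ) : ℂ) + c * q) ^ (-α - 1 / 2)) 0 :=
      ContinuousAt.cpow (by fun_prop) continuousAt_const (by simpa using hs)
    have := (hcont.tendsto.mono_left nhdsWithin_le_nhds :
      Tendsto _ (𝓝[>] (0 : ℝ)) _).const_mul (q * (q : ℂ) ^ (α - 1) * Complex.exp (-(q * Y)))
    simpa using this

/-- The Laplace integral in terms of the even and odd solutions: both sides solve Weber's equation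
along the ray `t ↦ t ζ`, and their initial values at `t = 0` agree. -/
theorem laplaceIntegral_eq_weber {α c Y ζ : ℂ} (hα : 0 < α.re) (hc : c ∈ Complex.slitPlane)
    (hY : 0 < Y.re) (hζ : ζ = (Real.sqrt 2 : ℂ) * Y ^ (1 / 2 : ℂ) * c ^ (-(1 / 2) : ℂ)) :
    laplaceIntegral 0 α c Y = Complex.exp (ζ ^ 2 / 4) * c ^ (-α) * Complex.Gamma (1 / 2) *
      (Complex.Gamma α / Complex.Gamma (α + 1 / 2) * weberEven (2 * α - 1 / 2) ζ -
        (Real.sqrt 2 : ℂ) * weberOdd (2 * α - 1 / 2) ζ) := by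
  have hY0 : Y ≠ 0 := fun h => by simp [h] at hY
  have hc0 := Complex.slitPlane_ne_zero hc
  have h2 : (Real.sqrt 2 : ℂ) ^ 2 = 2 := by
    rw [← Complex.ofReal_pow, Real.sq_sqrt (by norm_num)]
    norm_num
  have hY2 : (Y ^ (1 / 2 : ℂ)) ^ 2 = Y := by
    rw [← Complex.cpow_nat_mul]
    norm_num
  have hc2 : (c ^ (-(1 / 2) : ℂ)) ^ 2 = c⁻¹ := by
    rw [← Complex.cpow_nat_mul]
    norm_num [Complex.cpow_neg_one]
  have hζ2 : c * ζ ^ 2 = 2 * Y := by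
    rw [hζ, mul_pow, mul_pow, h2, hY2, hc2]
    field_simp
  have hζ0 : ζ ≠ 0 := fun h => by simp [h, hY0] at hζ2
  have hYt : ∀ t : ℝ, 0 < t → 0 < ((t : ℂ) ^ 2 * Y).re := fun t ht => by
    rw [← Complex.ofReal_pow, Complex.re_ofReal_mul]
    positivity
  have hK : ∀ j, ∀ t : ℝ, 0 < t → HasDerivAt (fun t : ℝ => laplaceIntegral j α c ((t : ℂ) ^ 2 * Y))
      (-laplaceIntegral (j + 1) α c ((t : ℂ) ^ 2 * Y) * (2 * t * Y)) t := fun j t ht => by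
    have h1 : HasDerivAt (fun w : ℂ => w ^ 2 * Y) (2 * t * Y) (t : ℂ) := by
      simpa using (hasDerivAt_pow 2 (t : ℂ)).mul_const Y
    exact (((hasDerivAt_laplaceIntegral j hα hc (hYt t ht)).comp (t : ℂ) h1)).comp_ofReal
  have hE : ∀ t : ℝ, HasDerivAt (fun t : ℝ => Complex.exp (-((t : ℂ) * ζ) ^ 2 / 4))
      (-(t * ζ / 2) * Complex.exp (-((t : ℂ) * ζ) ^ 2 / 4) * ζ) t := fun t => by
    have h1 : HasDerivAt (fun w : ℂ => w * ζ) ζ (t : ℂ) := by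
      simpa using (hasDerivAt_id (t : ℂ)).mul_const ζ
    exact ((hasDerivAt_exp_neg_sq_div_four ((t : ℂ) * ζ)).comp (t : ℂ) h1).comp_ofReal
  have hofReal : ∀ t : ℝ, HasDerivAt (fun t : ℝ => (t : ℂ)) 1 t :=
    fun t => Complex.ofRealCLM.hasDerivAt
  have hElim : Tendsto (fun t : ℝ => Complex.exp (-((t : ℂ) * ζ) ^ 2 / 4)) (𝓝[>] 0) (𝓝 1) := by
    simpa using ((hE 0).continuousAt.tendsto.mono_left nhdsWithin_le_nhds : Tendsto _ (𝓝[>] (0 : ℝ)) _)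
  have htlim : Tendsto (fun t : ℝ => (t : ℂ)) (𝓝[>] 0) (𝓝 0) := by
    simpa using ((hofReal 0).continuousAt.tendsto.mono_left nhdsWithin_le_nhds :
      Tendsto _ (𝓝[>] (0 : ℝ)) _)
  have hK0lim := tendsto_laplaceIntegral_zero hα hc hY
  have hK1lim := tendsto_mul_laplaceIntegral_one hα hc hY
  have key := eq_weber_of_tendsto (a := 2 * α - 1 / 2) (ζ := ζ)
    (g₀ := laplaceIntegral 0 α c 0)
    (g₁ := -((Real.sqrt 2 : ℂ) * c ^ (-α) * Complex.Gamma (1 / 2)))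
    (g := fun t : ℝ => Complex.exp (-((t : ℂ) * ζ) ^ 2 / 4) * laplaceIntegral 0 α c ((t : ℂ) ^ 2 * Y))
    (g' := fun t : ℝ => Complex.exp (-((t : ℂ) * ζ) ^ 2 / 4) *
      (-(t * (ζ ^ 2 / 2)) * laplaceIntegral 0 α c ((t : ℂ) ^ 2 * Y) -
        2 * Y * (t * laplaceIntegral 1 α c ((t : ℂ) ^ 2 * Y))))
    (fun t ht => by
      convert! (hE t).mul (hK 0 t ht) using 1
      ring)
    (fun t ht => by
      have ode := laplaceIntegral_ode hα hc (hYt t ht)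
      convert! (hE t).mul ((((hofReal t).mul_const (ζ ^ 2 / 2)).neg.mul (hK 0 t ht)).sub
        (((hofReal t).mul (hK 1 t ht)).const_mul (2 * Y))) using 1
      simp only [Pi.mul_apply, Pi.sub_apply, Pi.neg_apply]
      have hYe : Y = c * ζ ^ 2 / 2 := by rw [hζ2]; ring
      generalize laplaceIntegral 0 α c ((t : ℂ) ^ 2 * Y) = K0 at ode ⊢
      generalize laplaceIntegral 1 α c ((t : ℂ) ^ 2 * Y) = K1 at ode ⊢
      generalize laplaceIntegral 2 α c ((t : ℂ) ^ 2 * Y) = K2 at ode ⊢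
      rw [hYe] at ode ⊢
      linear_combination (2 * ζ ^ 2 * Complex.exp (-((t : ℂ) * ζ) ^ 2 / 4)) * ode)
    (by simpa using hElim.mul hK0lim)
    (by
      have := hElim.mul (((htlim.mul_const (ζ ^ 2 / 2)).neg.mul hK0lim).sub
        (hK1lim.const_mul (2 * Y)))
      convert! this using 2
      have h3 : (1 / Y) ^ (1 / 2 : ℂ) = Y ^ (1 / 2 : ℂ) / Y := by
        have harg : Y.arg ≠ Real.pi := (Complex.mem_slitPlane_iff_arg.1 (Or.inl hY)).1
        rw [one_div, Complex.inv_cpow _ _ harg]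
        have : Y ^ (1 / 2 : ℂ) ≠ 0 := fun h => hY0 (by rw [← hY2, h]; norm_num)
        rw [inv_eq_one_div, div_eq_div_iff this hY0, one_mul, ← sq, hY2]
      have h4 : c ^ (-α - 1 / 2) = c ^ (-α) * c ^ (-(1 / 2) : ℂ) := by
        rw [← Complex.cpow_add _ _ hc0]
        ring_nf
      rw [h3, h4, hζ]
      field_simp
      linear_combination (-2 * Y ^ (1 / 2 : ℂ) * c ^ (-α) * c ^ (-(1 / 2) : ℂ) * Complex.Gamma (1 / 2)) * h2)
    one_pos
  have key := mul_left_cancel₀ hζ0 key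
  simp only [Complex.ofReal_one, one_mul, one_pow] at key
  rw [laplaceIntegral_zero hα hc] at key
  have hexp : Complex.exp (ζ ^ 2 / 4) * Complex.exp (-ζ ^ 2 / 4) = 1 := by
    rw [← Complex.exp_add, ← Complex.exp_zero]
    ring_nf
  calc laplaceIntegral 0 α c Y
      = Complex.exp (ζ ^ 2 / 4) * (Complex.exp (-ζ ^ 2 / 4) * laplaceIntegral 0 α c Y) := by
        rw [← mul_assoc, hexp, one_mul]
    _ = _ := by
        rw [key]
        ring

/-! ### Analytic dependence of Hadamard finite parts on the exponent -/

theorem isOpen_compl_neg_nat : IsOpen {α : ℂ | ∀ n : ℕ, α ≠ -(n : ℂ)} := by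
  have h : {α : ℂ | ∀ n : ℕ, α ≠ -(n : ℂ)} = {α : ℂ | (Complex.Gamma α)⁻¹ ≠ 0} := by
    ext α
    simp [Complex.Gamma_eq_zero_iff]
  rw [h]
  exact isOpen_ne_fun Complex.differentiable_one_div_Gamma.continuous continuous_const

theorem isPreconnected_compl_neg_nat : IsPreconnected {α : ℂ | ∀ n : ℕ, α ≠ -(n : ℂ)} := by
  have h : {α : ℂ | ∀ n : ℕ, α ≠ -(n : ℂ)} = (Set.range fun n : ℕ => -(n : ℂ))ᶜ := by
    ext α
    simp [eq_comm]
  rw [h]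
  exact ((Set.countable_range _).isPathConnected_compl_of_one_lt_rank
    (Complex.rank_real_complex ▸ Nat.one_lt_ofNat)).isConnected.isPreconnected

theorem exists_le_norm_natCast_add {α₀ : ℂ} (h : ∀ n : ℕ, α₀ ≠ -(n : ℂ)) :
    ∃ δ : ℝ, 0 < δ ∧ ∀ α ∈ Metric.ball α₀ δ, ∀ n : ℕ, δ ≤ ‖(n : ℂ) + α‖ := by
  obtain ⟨ε, hε, hsub⟩ := Metric.isOpen_iff.1 isOpen_compl_neg_nat α₀ h
  refine ⟨ε / 2, half_pos hε, fun α hα n => ?_⟩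
  by_contra hn
  have hmem : -(n : ℂ) ∈ Metric.ball α₀ ε := by
    rw [Metric.mem_ball, dist_eq_norm] at hα ⊢
    have h1 : -(n : ℂ) - α₀ = (α - α₀) - ((n : ℂ) + α) := by ring
    rw [h1]
    linarith [norm_sub_le (α - α₀) ((n : ℂ) + α)]
  exact hsub hmem n rfl

/-- Principal powers split along a ray whose argument lies strictly between `-π` and `π`. -/
theorem ray_cpow {θ : ℝ} (hθ : θ ∈ Set.Ioo (-Real.pi) Real.pi) {t : ℝ} (ht : 0 < t) (β : ℂ) :
    ((t : ℂ) * Complex.exp (θ * Complex.I)) ^ β = (t : ℂ) ^ β * Complex.exp (θ * Complex.I * β) := by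
  rw [ofReal_mul_cpow ht (Complex.exp_ne_zero _), Complex.cpow_def_of_ne_zero (Complex.exp_ne_zero _),
    Complex.log_exp (by simpa using hθ.1) (by simpa using hθ.2.le)]

section Family

variable {Φ : ℂ → ℂ → ℂ} {r : ℝ}

/-- The Taylor coefficients in `p` of a jointly analytic family depend analytically on the
parameter. -/
theorem differentiable_iteratedDeriv_zero (hr : 0 < r)
    (hΦ : AnalyticOnNhd ℂ (fun q : ℂ × ℂ => Φ q.1 q.2) (Set.univ ×ˢ Metric.ball 0 r)) (n : ℕ) :
    Differentiable ℂ (fun α => iteratedDeriv n (Φ α) 0) := by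
  have hopen : IsOpen ((Set.univ : Set ℂ) ×ˢ Metric.ball (0 : ℂ) r) :=
    isOpen_univ.prod Metric.isOpen_ball
  have key : AnalyticOnNhd ℂ (fun q : ℂ × ℂ => iteratedDeriv n (Φ q.1) q.2)
      (Set.univ ×ˢ Metric.ball 0 r) := by
    induction n with
    | zero => simpa using hΦ
    | succ n ih =>
      have h1 : AnalyticOnNhd ℂ (fun q : ℂ × ℂ =>
          fderiv ℂ (fun q : ℂ × ℂ => iteratedDeriv n (Φ q.1) q.2) q (0, 1))
          (Set.univ ×ˢ Metric.ball 0 r) := fun q hq =>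
        ((ContinuousLinearMap.apply ℂ ℂ ((0, 1) : ℂ × ℂ)).analyticAt _).comp (ih.fderiv q hq)
      refine h1.congr hopen fun q hq => ?_
      have h2 : HasDerivAt (fun p : ℂ => (q.1, p)) ((0, 1) : ℂ × ℂ) q.2 :=
        (hasDerivAt_const _ _).prodMk (hasDerivAt_id _)
      have h3 := ((ih q hq).differentiableAt.hasFDerivAt).comp_hasDerivAt q.2 h2
      simp only [iteratedDeriv_succ]
      exact h3.deriv.symm
  intro α
  exact DifferentiableAt.comp (f := fun α : ℂ => (α, (0 : ℂ))) α
    (key (α, 0) ⟨Set.mem_univ _, Metric.mem_ball_self hr⟩).differentiableAt (by fun_prop)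

/-- A locally uniform geometric bound for the terms of the regularised integral over the initial
segment, by Cauchy's estimates on a circle between `x` and the boundary. -/
theorem exists_norm_taylor_term_le
    (hΦ : AnalyticOnNhd ℂ (fun q : ℂ × ℂ => Φ q.1 q.2) (Set.univ ×ˢ Metric.ball 0 r))
    {x : ℂ} (hx : ‖x‖ < r) (α₀ : ℂ) :
    ∃ u : ℕ → ℝ, Summable u ∧ ∀ α ∈ Metric.ball α₀ 1, ∀ n : ℕ,
      ‖iteratedDeriv n (Φ α) 0 / n.factorial * x ^ n‖ ≤ u n := by
  obtain ⟨ρ, hxρ, hρr⟩ := exists_between hx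
  have hρ : 0 < ρ := (norm_nonneg x).trans_lt hxρ
  have hcomp : IsCompact (Metric.closedBall α₀ 1 ×ˢ Metric.sphere (0 : ℂ) ρ) :=
    (isCompact_closedBall _ _).prod (isCompact_sphere _ _)
  have hsub : Metric.closedBall α₀ 1 ×ˢ Metric.sphere (0 : ℂ) ρ ⊆
      Set.univ ×ˢ Metric.ball (0 : ℂ) r := by
    rintro ⟨α, p⟩ ⟨-, hp⟩
    refine ⟨Set.mem_univ _, ?_⟩
    rw [mem_sphere_zero_iff_norm] at hp
    rw [mem_ball_zero_iff]
    exact hp.le.trans_lt hρr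
  obtain ⟨M, hM⟩ := hcomp.exists_bound_of_continuousOn (hΦ.continuousOn.mono hsub)
  refine ⟨fun n => M * (‖x‖ / ρ) ^ n,
    (summable_geometric_of_lt_one (by positivity) (by rwa [div_lt_one hρ])).mul_left M,
    fun α hα n => ?_⟩
  have hd : DifferentiableOn ℂ (Φ α) (Metric.closedBall 0 ρ) := fun p hp => by
    have hp' : p ∈ Metric.ball (0 : ℂ) r := Metric.closedBall_subset_ball hρr hp
    exact ((hΦ (α, p) ⟨Set.mem_univ _, hp'⟩).differentiableAt.comp p
      ((differentiableAt_const _).prodMk differentiableAt_id)).differentiableWithinAt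
  have h1 := Complex.norm_iteratedDeriv_le_of_forall_mem_sphere_norm_le n hρ
    (hd.diffContOnCl_ball subset_rfl)
    (fun p hp => hM (α, p) ⟨Metric.ball_subset_closedBall hα, hp⟩)
  have hf : (0 : ℝ) < n.factorial := by exact_mod_cast n.factorial_pos
  rw [norm_mul, norm_div, norm_pow, Complex.norm_natCast]
  calc ‖iteratedDeriv n (Φ α) 0‖ / n.factorial * ‖x‖ ^ n
      ≤ (n.factorial * M / ρ ^ n) / n.factorial * ‖x‖ ^ n := by gcongr
    _ = M * (‖x‖ / ρ) ^ n := by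
      rw [div_pow]
      field_simp

/-- The regularised integral of `p ^ (α - 1) * Φ α p` over the segment from `0` to `x`. The function
`Φ α` may depend on the exponent, and the power `x ^ α` is taken out of the series. -/
noncomputable def segmentFinitePart (Φ : ℂ → ℂ → ℂ) (x α : ℂ) : ℂ :=
  x ^ α * ∑' n : ℕ, iteratedDeriv n (Φ α) 0 / n.factorial * x ^ n / ((n : ℂ) + α)

/-- A summable majorant for the series of `segmentFinitePart`, uniform in the exponent near a point
that is not a pole. -/
theorem summable_segmentFinitePart
    (hΦ : AnalyticOnNhd ℂ (fun q : ℂ × ℂ => Φ q.1 q.2) (Set.univ ×ˢ Metric.ball 0 r))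
    {x : ℂ} (hx : ‖x‖ < r) (α₀ : ℂ) (hα₀ : ∀ n : ℕ, α₀ ≠ -(n : ℂ)) :
    ∃ (δ : ℝ) (u : ℕ → ℝ), 0 < δ ∧ Summable u ∧ ∀ n : ℕ, ∀ α ∈ Metric.ball α₀ δ,
      (n : ℂ) + α ≠ 0 ∧
      ‖iteratedDeriv n (Φ α) 0 / n.factorial * x ^ n / ((n : ℂ) + α)‖ ≤ u n := by
  obtain ⟨u, hu, h⟩ := exists_norm_taylor_term_le hΦ hx α₀
  obtain ⟨δ, hδ, hδ'⟩ := exists_le_norm_natCast_add hα₀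
  refine ⟨min δ 1, fun n => u n / δ, by positivity, hu.div_const _, fun n α hα => ?_⟩
  have h1 := hδ' α (Metric.ball_subset_ball (min_le_left _ _) hα) n
  have h2 := h α (Metric.ball_subset_ball (min_le_right _ _) hα) n
  refine ⟨norm_pos_iff.1 (hδ.trans_le h1), ?_⟩
  rw [norm_div]
  exact div_le_div₀ ((norm_nonneg _).trans h2) h2 hδ h1

/-- The regularised integral is the sum of the series in the definition of the finite part. -/
theorem hasSum_segmentFinitePart
    (hΦ : AnalyticOnNhd ℂ (fun q : ℂ × ℂ => Φ q.1 q.2) (Set.univ ×ˢ Metric.ball 0 r))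
    {x : ℂ} (hx0 : x ≠ 0) (hx : ‖x‖ < r) {α : ℂ} (hα : ∀ n : ℕ, α ≠ -(n : ℂ)) :
    HasSum (fun n : ℕ => iteratedDeriv n (Φ α) 0 / n.factorial / ((n : ℂ) + α) *
      x ^ ((n : ℂ) + α)) (segmentFinitePart Φ x α) := by
  obtain ⟨δ, u, hδ, hu, h⟩ := summable_segmentFinitePart hΦ hx α hα
  have hs : Summable fun n : ℕ => iteratedDeriv n (Φ α) 0 / n.factorial * x ^ n / ((n : ℂ) + α) :=
    Summable.of_norm_bounded hu fun n => (h n α (Metric.mem_ball_self hδ)).2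
  refine (hs.hasSum.mul_left (x ^ α)).congr_fun fun n => ?_
  rw [Complex.cpow_add _ _ hx0, Complex.cpow_natCast]
  ring

theorem differentiableOn_segmentFinitePart
    (hΦ : AnalyticOnNhd ℂ (fun q : ℂ × ℂ => Φ q.1 q.2) (Set.univ ×ˢ Metric.ball 0 r))
    {x : ℂ} (hx0 : x ≠ 0) (hx : ‖x‖ < r) :
    DifferentiableOn ℂ (segmentFinitePart Φ x) {α : ℂ | ∀ n : ℕ, α ≠ -(n : ℂ)} := by
  intro α₀ hα₀
  obtain ⟨δ, u, hδ, hu, h⟩ := summable_segmentFinitePart hΦ hx α₀ hα₀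
  have hr : 0 < r := (norm_nonneg x).trans_lt hx
  have hd := Complex.differentiableOn_tsum_of_summable_norm hu
    (F := fun (n : ℕ) α => iteratedDeriv n (Φ α) 0 / n.factorial * x ^ n / ((n : ℂ) + α))
    (U := Metric.ball α₀ δ)
    (fun n α hα => by
      have h1 := (differentiable_iteratedDeriv_zero hr hΦ n) α
      exact (((h1.div_const _).mul_const _).div (by fun_prop)
        (h n α hα).1).differentiableWithinAt)
    Metric.isOpen_ball (fun n α hα => (h n α hα).2)
  have h1 := hd.differentiableAt (Metric.ball_mem_nhds α₀ hδ)
  refine DifferentiableAt.differentiableWithinAt (DifferentiableAt.mul ?_ h1)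
  exact differentiableAt_id.const_cpow (Or.inl hx0)

/-- For `0 < Re α` the regularised integral over the initial segment is the Lebesgue integral. -/
theorem integral_rayIntegrand_eq_segmentFinitePart
    (hΦ : AnalyticOnNhd ℂ (fun q : ℂ × ℂ => Φ q.1 q.2) (Set.univ ×ˢ Metric.ball 0 r))
    {θ R : ℝ} (hR0 : 0 < R) (hRr : R < r) {α : ℂ} (hα : 0 < α.re) (hθ : θ ∈ Set.Ioo (-Real.pi) Real.pi) :
    ∫ t in Set.Ioc 0 R, rayIntegrand θ α (Φ α) t =
      segmentFinitePart Φ ((R : ℂ) * Complex.exp (θ * Complex.I)) α := by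
  set E := Complex.exp (θ * Complex.I) with hE
  have hE0 : E ≠ 0 := Complex.exp_ne_zero _
  have hEn : ‖E‖ = 1 := Complex.norm_exp_ofReal_mul_I θ
  have hR' : (R : ℂ) ≠ 0 := by exact_mod_cast hR0.ne'
  have hx : ‖(R : ℂ) * E‖ < r := by
    rwa [norm_mul, hEn, mul_one, Complex.norm_real, Real.norm_of_nonneg hR0.le]
  have hpole : ∀ n : ℕ, α ≠ -(n : ℂ) := fun n h => by
    rw [h] at hα
    simp at hα
    linarith [(Nat.cast_nonneg n : (0 : ℝ) ≤ n)]
  set b : ℕ → ℂ := fun n => iteratedDeriv n (Φ α) 0 / n.factorial with hb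
  obtain ⟨u, hu, hbu⟩ := exists_norm_taylor_term_le hΦ hx α
  have hbu := hbu α (Metric.mem_ball_self one_pos)
  have hdiff : DifferentiableOn ℂ (Φ α) (Metric.ball 0 r) := fun p hp =>
    ((hΦ (α, p) ⟨Set.mem_univ _, hp⟩).differentiableAt.comp p
      ((differentiableAt_const _).prodMk differentiableAt_id)).differentiableWithinAt
  have hw : MeasureTheory.IntegrableOn (fun t : ℝ => ((t : ℂ) * E) ^ (α - 1) * E) (Set.Ioc 0 R) := by
    have h1 := intervalIntegral.intervalIntegrable_cpow' (a := 0) (b := R) (r := α - 1)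
      (by simpa using hα)
    rw [intervalIntegrable_iff_integrableOn_Ioc_of_le hR0.le] at h1
    refine MeasureTheory.IntegrableOn.congr_fun
      (h1.mul_const (Complex.exp (θ * Complex.I * (α - 1)) * E)) (fun t ht => ?_) measurableSet_Ioc
    simp only [hE]
    rw [ray_cpow hθ ht.1]
    ring
  have hterm : ∀ n : ℕ, ∀ t ∈ Set.Ioc 0 R, b n * ((t : ℂ) * E) ^ n * (((t : ℂ) * E) ^ (α - 1) * E) =
      b n * Complex.exp (θ * Complex.I * (n + α)) * (t : ℂ) ^ ((n : ℂ) + α - 1) := by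
    intro n t ht
    have ht0 : (t : ℂ) ≠ 0 := by exact_mod_cast ht.1.ne'
    have h1 : E ^ n * (Complex.exp (θ * Complex.I * (α - 1)) * E) =
        Complex.exp (θ * Complex.I * (n + α)) := by
      rw [hE, ← Complex.exp_nat_mul, ← Complex.exp_add, ← Complex.exp_add]
      ring_nf
    rw [hE, ray_cpow hθ ht.1, ← hE, mul_pow, ← h1, add_sub_assoc, Complex.cpow_add _ _ ht0,
      Complex.cpow_natCast]
    ring
  have hsum := MeasureTheory.hasSum_integral_of_dominated_convergence
    (μ := MeasureTheory.volume.restrict (Set.Ioc 0 R))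
    (F := fun (n : ℕ) (t : ℝ) => b n * ((t : ℂ) * E) ^ n * (((t : ℂ) * E) ^ (α - 1) * E))
    (f := rayIntegrand θ α (Φ α))
    (fun n t => u n * ‖((t : ℂ) * E) ^ (α - 1) * E‖)
    (fun n => (by fun_prop : Measurable _).aestronglyMeasurable)
    (fun n => by
      filter_upwards [MeasureTheory.ae_restrict_mem measurableSet_Ioc] with t ht
      have h1 : ‖b n * ((t : ℂ) * E) ^ n‖ ≤ u n := by
        refine le_trans ?_ (hbu n)
        rw [norm_mul, norm_mul, norm_pow, norm_pow, norm_mul, norm_mul, Complex.norm_real,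
          Complex.norm_real, Real.norm_of_nonneg ht.1.le, Real.norm_of_nonneg hR0.le]
        have := ht.2
        have := ht.1
        gcongr
      rw [norm_mul]
      gcongr)
    (Eventually.of_forall fun t => hu.mul_right _)
    (by
      simp_rw [tsum_mul_right]
      exact hw.norm.const_mul _)
    (by
      filter_upwards [MeasureTheory.ae_restrict_mem measurableSet_Ioc] with t ht
      have hmem : (t : ℂ) * E ∈ Metric.ball (0 : ℂ) r := by
        rw [mem_ball_zero_iff, norm_mul, hEn, mul_one, Complex.norm_real,
          Real.norm_of_nonneg ht.1.le]
        exact ht.2.trans_lt hRr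
      have h1 := (Complex.hasSum_taylorSeries_on_ball hdiff hmem).mul_right
        (((t : ℂ) * E) ^ (α - 1) * E)
      convert! h1 using 1
      · ext n
        simp only [hb, smul_eq_mul, sub_zero]
        ring
      · rw [rayIntegrand]
        ring)
  refine hsum.unique ((hasSum_segmentFinitePart hΦ (mul_ne_zero hR' hE0) hx hpole).congr_fun
    fun n => ?_)
  rw [MeasureTheory.setIntegral_congr_fun measurableSet_Ioc (hterm n),
    MeasureTheory.integral_const_mul, ← intervalIntegral.integral_of_le hR0.le,
    integral_cpow (Or.inl (by
      simp
      linarith [(Nat.cast_nonneg n : (0 : ℝ) ≤ n)])), hE, ray_cpow hθ hR0]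
  have h2 : (n : ℂ) + α ≠ 0 := fun h => hpole n (by linear_combination h)
  rw [sub_add_cancel, Complex.ofReal_zero, Complex.zero_cpow h2]
  simp only [hb]
  ring

end Family

/-! ### The parabolic cylinder function `U` and its integral representation -/

/-- The parabolic cylinder function `U(a, z)`, defined by its initial values at `0`. At a pole of `Γ`
Mathlib's value `Γ = 0` and division by zero give the coefficient `0`, as intended. -/
noncomputable def parabolicU (a z : ℂ) : ℂ :=
  (Real.sqrt Real.pi : ℂ) / ((2 : ℂ) ^ (a / 2 + 1 / 4) * Complex.Gamma (3 / 4 + a / 2)) *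
      weberEven a z +
    -(Real.sqrt Real.pi : ℂ) / ((2 : ℂ) ^ (a / 2 - 1 / 4) * Complex.Gamma (1 / 4 + a / 2)) *
      weberOdd a z

theorem Differentiable.inv_Gamma {E : Type*} [NormedAddCommGroup E] [NormedSpace ℂ E] {f : E → ℂ}
    (hf : Differentiable ℂ f) : Differentiable ℂ (fun x => (Complex.Gamma (f x))⁻¹) :=
  Complex.differentiable_one_div_Gamma.comp hf

theorem differentiable_parabolicU : Differentiable ℂ (fun q : ℂ × ℂ => parabolicU q.1 q.2) := by
  have h1 : Differentiable ℂ (fun q : ℂ × ℂ => (Complex.Gamma (3 / 4 + q.1 / 2))⁻¹) :=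
    Differentiable.inv_Gamma (by fun_prop)
  have h2 : Differentiable ℂ (fun q : ℂ × ℂ => (Complex.Gamma (1 / 4 + q.1 / 2))⁻¹) :=
    Differentiable.inv_Gamma (by fun_prop)
  have h3 : ∀ f : ℂ × ℂ → ℂ, Differentiable ℂ f → Differentiable ℂ (fun q => ((2 : ℂ) ^ f q)⁻¹) :=
    fun f hf => (hf.const_cpow (Or.inl two_ne_zero)).inv fun q => by simp [Complex.cpow_eq_zero_iff]
  have h4 := differentiable_weberEven
  have h5 := differentiable_weberOdd
  unfold parabolicU
  simp only [div_eq_mul_inv, mul_inv] at h1 h2 ⊢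
  exact (((h3 _ (by fun_prop)).mul h1).const_mul _).mul h4 |>.add
    ((((h3 _ (by fun_prop)).mul h2).const_mul _).mul h5)

theorem Gamma_half_eq_sqrt : Complex.Gamma (1 / 2) = (Real.sqrt Real.pi : ℂ) := by
  rw [Complex.Gamma_one_half_eq, Real.sqrt_eq_rpow, Complex.ofReal_cpow Real.pi_pos.le]
  push_cast
  rfl

/-- The Laplace integral as a parabolic cylinder function: `laplaceIntegral_eq_weber` with the
coefficients recognised as the initial values of `U`. -/
theorem laplaceIntegral_eq_parabolicU {α c Y ζ : ℂ} (hα : 0 < α.re) (hc : c ∈ Complex.slitPlane)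
    (hY : 0 < Y.re) (hζ : ζ = (Real.sqrt 2 : ℂ) * Y ^ (1 / 2 : ℂ) * c ^ (-(1 / 2) : ℂ)) :
    laplaceIntegral 0 α c Y = Complex.Gamma α * (2 : ℂ) ^ α * c ^ (-α) * Complex.exp (ζ ^ 2 / 4) *
      parabolicU (2 * α - 1 / 2) ζ := by
  have hG := Complex.Gamma_ne_zero_of_re_pos hα
  have hG2 := Complex.Gamma_ne_zero_of_re_pos (s := α + 1 / 2) (by simp; linarith)
  have h2 : (2 : ℂ) ^ α ≠ 0 := by simp [Complex.cpow_eq_zero_iff]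
  have hs : (Real.sqrt 2 : ℂ) ≠ 0 := by
    rw [Ne, Complex.ofReal_eq_zero, Real.sqrt_eq_zero']
    norm_num
  have h3 : (2 : ℂ) ^ (α - 1 / 2) = (2 : ℂ) ^ α / (Real.sqrt 2 : ℂ) := by
    rw [Complex.cpow_sub _ _ two_ne_zero, Real.sqrt_eq_rpow, Complex.ofReal_cpow (by norm_num)]
    push_cast
    rfl
  rw [laplaceIntegral_eq_weber hα hc hY hζ, parabolicU, Gamma_half_eq_sqrt,
    show (2 * α - 1 / 2) / 2 + 1 / 4 = α by ring, show 3 / 4 + (2 * α - 1 / 2) / 2 = α + 1 / 2 by ring,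
    show (2 * α - 1 / 2) / 2 - 1 / 4 = α - 1 / 2 by ring,
    show 1 / 4 + (2 * α - 1 / 2) / 2 = α by ring, h3]
  field_simp
  ring

/-- The integrand along the ray of angle `θ`, as an integrand over `(0, ∞)`. -/
theorem rayIntegrand_eq_laplaceIntegrand {θ : ℝ} (hθ : θ ∈ Set.Ioo (-Real.pi) Real.pi)
    (α ε y : ℂ) {t : ℝ} (ht : 0 < t) :
    rayIntegrand θ α (fun p => Complex.exp (-(p * y)) * (1 + ε * p) ^ (-α - 1 / 2)) t =
      Complex.exp (θ * Complex.I * α) * laplaceIntegrand 0 α (ε * Complex.exp (θ * Complex.I))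
        (Complex.exp (θ * Complex.I) * y) t := by
  have h1 : Complex.exp (θ * Complex.I * (α - 1)) * Complex.exp (θ * Complex.I) =
      Complex.exp (θ * Complex.I * α) := by
    rw [← Complex.exp_add]
    ring_nf
  rw [rayIntegrand, ray_cpow hθ ht, laplaceIntegrand, ← h1]
  ring_nf

theorem rpow_le_rpow_add_rpow_neg {m p N : ℝ} (hm : 0 < m) (hp : |p| ≤ N) :
    m ^ p ≤ m ^ N + m ^ (-N) := by
  obtain ⟨h1, h2⟩ := abs_le.1 hp
  rcases le_total 1 m with h | h
  · have := Real.rpow_le_rpow_of_exponent_le h h2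
    have : 0 < m ^ (-N) := by positivity
    linarith
  · have := Real.rpow_le_rpow_of_exponent_ge hm h h1
    have : 0 < m ^ N := by positivity
    linarith

/-- A bound for the integrand away from the origin, locally uniform in the exponent. -/
theorem exists_norm_laplaceIntegrand_tail_le {c : ℂ} (hc : c ∈ Complex.slitPlane) {R : ℝ}
    (hR : 0 < R) (Y : ℂ) (α₀ : ℂ) :
    ∃ C N : ℝ, ∀ α ∈ Metric.ball α₀ 1, ∀ t ∈ Set.Ioi R, ‖laplaceIntegrand 0 α c Y t‖ ≤
      C * (t ^ (0 : ℝ) * (1 + t) ^ N * Real.exp (-(Y.re * t))) := by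
  obtain ⟨κ, hκ, hlow⟩ := exists_le_norm_add_mul hc
  set N : ℝ := ‖α₀‖ + 3 with hN
  have hN0 : 0 ≤ N := by positivity
  set L : ℝ := 1 + ‖c‖ with hL
  have hL0 : 0 < L := by positivity
  refine ⟨(1 + R ^ (-N)) * ((L ^ N + L ^ (-N) + (κ ^ N + κ ^ (-N))) * Real.exp (Real.pi * N) * 2),
    N + N, fun α hα t ht => ?_⟩
  have ht0 : 0 < t := hR.trans ht
  have hαN : ‖α‖ ≤ ‖α₀‖ + 1 := by
    rw [Metric.mem_ball, dist_eq_norm] at hα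
    have := norm_add_le α₀ (α - α₀)
    rw [add_sub_cancel] at this
    linarith
  have hre : |(α - 1).re| ≤ N := by
    refine (Complex.abs_re_le_norm _).trans ((norm_sub_le _ _).trans ?_)
    simp
    linarith
  have hβ : ‖-α - 1 / 2‖ ≤ N := by
    refine (norm_sub_le _ _).trans ?_
    rw [norm_neg]
    norm_num
    linarith
  have hβre := (Complex.abs_re_le_norm _).trans hβ
  have hβim := (Complex.abs_im_le_norm _).trans hβ
  have h1t : 1 ≤ 1 + t := by linarith
  have hA : t ^ (α - 1).re ≤ (1 + R ^ (-N)) * (1 + t) ^ N := by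
    have e1 := rpow_le_rpow_add_rpow_neg ht0 hre
    have e2 : t ^ N ≤ (1 + t) ^ N := Real.rpow_le_rpow ht0.le (by linarith) hN0
    have e3 : t ^ (-N) ≤ R ^ (-N) := Real.rpow_le_rpow_of_nonpos hR ht.le (by linarith)
    have e4 : 1 ≤ (1 + t) ^ N := Real.one_le_rpow h1t hN0
    have e5 : 0 < R ^ (-N) := by positivity
    nlinarith
  have hB : ‖(1 + c * t) ^ (-α - 1 / 2)‖ ≤
      (L ^ N + L ^ (-N) + (κ ^ N + κ ^ (-N))) * Real.exp (Real.pi * N) * (2 * (1 + t) ^ N) := by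
    have e1 := hlow 1 t zero_le_one ht0.le
    have e2 := norm_add_mul_le c zero_le_one ht0.le
    push_cast at e1 e2
    refine (norm_cpow_le_of_norm_bounds (β := -α - 1 / 2) hκ (by positivity) e1 e2).trans ?_
    have e3 := rpow_le_rpow_add_rpow_neg hL0 hβre
    have e4 := rpow_le_rpow_add_rpow_neg hκ hβre
    have e5 : (1 + t) ^ (-α - 1 / 2).re ≤ 2 * (1 + t) ^ N := by
      have := Real.rpow_le_rpow_of_exponent_le h1t (abs_le.1 hβre).2
      have : 0 < (1 + t) ^ N := by positivity
      linarith
    have := Real.pi_pos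
    gcongr
  have h3 : (-((t : ℂ) * Y)).re = -(Y.re * t) := by simp [mul_comm]
  rw [laplaceIntegrand, pow_zero, one_mul, norm_mul, norm_mul, Complex.norm_exp,
    Complex.norm_cpow_eq_rpow_re_of_pos ht0, h3, Real.rpow_zero, one_mul,
    Real.rpow_add (zero_lt_one.trans_le h1t) N N]
  calc Real.exp (-(Y.re * t)) * (t ^ (α - 1).re * ‖(1 + c * t) ^ (-α - 1 / 2)‖)
      ≤ Real.exp (-(Y.re * t)) * ((1 + R ^ (-N)) * (1 + t) ^ N *
        ((L ^ N + L ^ (-N) + (κ ^ N + κ ^ (-N))) * Real.exp (Real.pi * N) * (2 * (1 + t) ^ N))) := by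
        gcongr
    _ = _ := by ring

theorem integrableOn_tail_bound {Y : ℂ} (hY : 0 < Y.re) {R : ℝ} (hR : 0 < R) (C N : ℝ) :
    MeasureTheory.IntegrableOn (fun t : ℝ => C * (t ^ (0 : ℝ) * (1 + t) ^ N *
      Real.exp (-(Y.re * t)))) (Set.Ioi R) :=
  MeasureTheory.IntegrableOn.mono_set
    ((integrableOn_rpow_mul_one_add_rpow_mul_exp (p := 0) (by norm_num) hY).const_mul C)
    (Set.Ioi_subset_Ioi hR.le)

theorem integrableOn_laplaceIntegrand_tail {c Y : ℂ} (hc : c ∈ Complex.slitPlane) (hY : 0 < Y.re)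
    {R : ℝ} (hR : 0 < R) (α : ℂ) :
    MeasureTheory.IntegrableOn (laplaceIntegrand 0 α c Y) (Set.Ioi R) := by
  obtain ⟨C, N, h⟩ := exists_norm_laplaceIntegrand_tail_le hc hR Y α
  refine MeasureTheory.Integrable.mono' (integrableOn_tail_bound hY hR C N)
    (measurable_laplaceIntegrand _ _ _ _).aestronglyMeasurable ?_
  filter_upwards [MeasureTheory.ae_restrict_mem measurableSet_Ioi] with t ht
  exact h α (Metric.mem_ball_self one_pos) t ht

/-- Away from the origin the integral is entire in the exponent. -/
theorem differentiable_integral_laplaceIntegrand_tail {c Y : ℂ} (hc : c ∈ Complex.slitPlane)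
    (hY : 0 < Y.re) {R : ℝ} (hR : 0 < R) :
    Differentiable ℂ (fun α => ∫ t in Set.Ioi R, laplaceIntegrand 0 α c Y t) := by
  intro α₀
  obtain ⟨C, N, h⟩ := exists_norm_laplaceIntegrand_tail_le hc hR Y α₀
  have hd : ∀ t ∈ Set.Ioi R, Differentiable ℂ (fun α => laplaceIntegrand 0 α c Y t) := by
    intro t ht
    have ht : 0 < t := hR.trans ht
    have h1 : (t : ℂ) ≠ 0 := by exact_mod_cast ht.ne'
    have h2 := Complex.slitPlane_ne_zero (one_add_mul_mem_slitPlane hc ht.le)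
    unfold laplaceIntegrand
    refine Differentiable.const_mul (Differentiable.mul ?_ ?_) _
    · exact Differentiable.const_cpow (by fun_prop) (Or.inl h1)
    · exact Differentiable.const_cpow (by fun_prop) (Or.inl h2)
  exact (hasDerivAt_integral_of_differentiableOn
    (μ := MeasureTheory.volume.restrict (Set.Ioi R)) (F := fun α => laplaceIntegrand 0 α c Y)
    (F' := fun t => deriv (fun α => laplaceIntegrand 0 α c Y t) α₀) one_pos
    (fun w _ => (measurable_laplaceIntegrand _ _ _ _).aestronglyMeasurable)
    (by
      filter_upwards [MeasureTheory.ae_restrict_mem measurableSet_Ioi] with t ht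
      exact (hd t ht).differentiableOn)
    (by
      filter_upwards [MeasureTheory.ae_restrict_mem measurableSet_Ioi] with t ht w hw
      exact h w hw t ht)
    (integrableOn_tail_bound hY hR C N)
    (by
      filter_upwards [MeasureTheory.ae_restrict_mem measurableSet_Ioi] with t ht
      exact (hd t ht α₀).hasDerivAt)).2.differentiableAt

/-- The value of the integral of `e^{-py} p^{α-1} (1 + ε p)^{-α-1/2}` along the ray of angle `θ`,
both as a Lebesgue integral and as a finite part. The finite part is reached by analytic
continuation in `α`. -/
theorem hasRayValue_parabolicU {θ : ℝ} (hθ : θ ∈ Set.Ioo (-Real.pi) Real.pi) {ε y ζ : ℂ}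
    (hε : ‖ε‖ ≤ 2) (hc : ε * Complex.exp (θ * Complex.I) ∈ Complex.slitPlane)
    (hY : 0 < (Complex.exp (θ * Complex.I) * y).re)
    (hζ : ζ = (Real.sqrt 2 : ℂ) * (Complex.exp (θ * Complex.I) * y) ^ (1 / 2 : ℂ) *
      (ε * Complex.exp (θ * Complex.I)) ^ (-(1 / 2) : ℂ))
    {α : ℂ} (hα : ∀ n : ℕ, α ≠ -(n : ℂ)) :
    HasRayValue θ α (fun p => Complex.exp (-(p * y)) * (1 + ε * p) ^ (-α - 1 / 2))
      (Complex.exp (θ * Complex.I * α) * (Complex.Gamma α * (2 : ℂ) ^ α *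
        (ε * Complex.exp (θ * Complex.I)) ^ (-α) * Complex.exp (ζ ^ 2 / 4) *
          parabolicU (2 * α - 1 / 2) ζ)) := by
  set c := ε * Complex.exp (θ * Complex.I) with hcdef
  set Y := Complex.exp (θ * Complex.I) * y with hYdef
  set Φ : ℂ → ℂ → ℂ := fun α p => Complex.exp (-(p * y)) * (1 + ε * p) ^ (-α - 1 / 2) with hΦdef
  have hslit : ∀ p ∈ Metric.ball (0 : ℂ) (1 / 2), 1 + ε * p ∈ Complex.slitPlane := by
    intro p hp
    rw [mem_ball_zero_iff] at hp
    have h1 : ‖ε * p‖ < 1 := by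
      rw [norm_mul]
      nlinarith [norm_nonneg ε, norm_nonneg p]
    left
    have h2 := (abs_le.1 (Complex.abs_re_le_norm (ε * p))).1
    rw [Complex.add_re, Complex.one_re]
    linarith
  have hΦ : AnalyticOnNhd ℂ (fun q : ℂ × ℂ => Φ q.1 q.2) (Set.univ ×ˢ Metric.ball 0 (1 / 2)) := by
    rintro ⟨α, p⟩ ⟨-, hp⟩
    have hs := hslit p hp
    simp only [hΦdef]
    exact (analyticAt_snd.mul analyticAt_const).neg.cexp.mul
      ((analyticAt_const.add (analyticAt_const.mul analyticAt_snd)).cpow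
        (analyticAt_fst.neg.sub analyticAt_const) hs)
  have hray : ∀ β : ℂ, ∀ t : ℝ, 0 < t → rayIntegrand θ β (Φ β) t =
      Complex.exp (θ * Complex.I * β) * laplaceIntegrand 0 β c Y t :=
    fun β t ht => rayIntegrand_eq_laplaceIntegrand hθ β ε y ht
  set J : ℂ → ℂ := fun β => Complex.exp (θ * Complex.I * β) * (Complex.Gamma β * (2 : ℂ) ^ β *
    c ^ (-β) * Complex.exp (ζ ^ 2 / 4) * parabolicU (2 * β - 1 / 2) ζ) with hJ
  have hleb : ∀ β : ℂ, 0 < β.re → HasRayIntegral θ β (Φ β) (J β) := by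
    intro β hβ
    have hi := integrableOn_laplaceIntegrand 0 hβ hc hY
    refine ⟨MeasureTheory.IntegrableOn.congr_fun (hi.const_mul (Complex.exp (θ * Complex.I * β)))
      (fun t ht => (hray β t ht).symm) measurableSet_Ioi, ?_⟩
    rw [MeasureTheory.setIntegral_congr_fun measurableSet_Ioi (fun t ht => hray β t ht),
      MeasureTheory.integral_const_mul]
    simp only [hJ]
    rw [← laplaceIntegral_eq_parabolicU hβ hc hY hζ]
    rfl
  refine ⟨fun h => hleb α h, fun _ => ⟨hα, 1 / 2, by norm_num, ?_, fun R hR => ?_⟩⟩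
  · intro p hp
    refine DifferentiableAt.differentiableWithinAt ?_
    exact DifferentiableAt.mul (by fun_prop)
      (DifferentiableAt.cpow (by fun_prop) (by fun_prop) (hslit p hp))
  set x := (R : ℂ) * Complex.exp (θ * Complex.I) with hx
  have hR0 : 0 < R := hR.1
  have hR0' : (R : ℂ) ≠ 0 := by exact_mod_cast hR0.ne'
  have hx0 : x ≠ 0 := mul_ne_zero hR0' (Complex.exp_ne_zero _)
  have hxr : ‖x‖ < 1 / 2 := by
    rw [hx, norm_mul, Complex.norm_exp_ofReal_mul_I, mul_one, Complex.norm_real,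
      Real.norm_of_nonneg hR0.le]
    exact hR.2
  have htail : ∀ β : ℂ, ∫ t in Set.Ioi R, rayIntegrand θ β (Φ β) t =
      Complex.exp (θ * Complex.I * β) * ∫ t in Set.Ioi R, laplaceIntegrand 0 β c Y t := by
    intro β
    rw [← MeasureTheory.integral_const_mul]
    exact MeasureTheory.setIntegral_congr_fun measurableSet_Ioi
      fun t ht => hray β t (hR0.trans ht)
  have htailint : ∀ β : ℂ, MeasureTheory.IntegrableOn (rayIntegrand θ β (Φ β)) (Set.Ioi R) :=
    fun β => MeasureTheory.IntegrableOn.congr_fun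
      ((integrableOn_laplaceIntegrand_tail hc hY hR0 β).const_mul (Complex.exp (θ * Complex.I * β)))
      (fun t ht => (hray β t (hR0.trans ht)).symm) measurableSet_Ioi
  refine ⟨segmentFinitePart Φ x α, hasSum_segmentFinitePart hΦ hx0 hxr hα, htailint α, ?_⟩
  have hP : DifferentiableOn ℂ J {α : ℂ | ∀ n : ℕ, α ≠ -(n : ℂ)} := by
    intro β hβ
    refine DifferentiableAt.differentiableWithinAt ?_
    have h1 : DifferentiableAt ℂ (fun β => parabolicU (2 * β - 1 / 2) ζ) β :=
      (differentiable_parabolicU.comp (by fun_prop :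
        Differentiable ℂ (fun β : ℂ => (2 * β - 1 / 2, ζ)))) β
    have h2 := Complex.differentiableAt_Gamma β hβ
    have h3 : DifferentiableAt ℂ (fun β : ℂ => (2 : ℂ) ^ β) β :=
      differentiableAt_id.const_cpow (Or.inl two_ne_zero)
    have h4 : DifferentiableAt ℂ (fun β : ℂ => c ^ (-β)) β :=
      differentiableAt_id.neg.const_cpow (Or.inl (Complex.slitPlane_ne_zero hc))
    exact DifferentiableAt.mul (by fun_prop) ((((h2.mul h3).mul h4).mul_const _).mul h1)
  have hQ : DifferentiableOn ℂ (fun β => segmentFinitePart Φ x β +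
      ∫ t in Set.Ioi R, rayIntegrand θ β (Φ β) t) {α : ℂ | ∀ n : ℕ, α ≠ -(n : ℂ)} := by
    simp_rw [htail]
    refine (differentiableOn_segmentFinitePart hΦ hx0 hxr).add (Differentiable.differentiableOn ?_)
    exact Differentiable.mul (by fun_prop)
      (differentiable_integral_laplaceIntegrand_tail hc hY hR0)
  -- both sides are analytic off the poles and agree on the half-plane `0 < Re α`, near `α = 1`
  refine (hP.analyticOnNhd isOpen_compl_neg_nat).eqOn_of_preconnected_of_eventuallyEq
    (hQ.analyticOnNhd isOpen_compl_neg_nat) isPreconnected_compl_neg_nat (z₀ := 1) ?_ ?_ hα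
  · intro n h
    have := congrArg Complex.re h
    simp at this
    linarith [(Nat.cast_nonneg n : (0 : ℝ) ≤ n)]
  · have hopen : IsOpen {β : ℂ | 0 < β.re} := isOpen_lt continuous_const Complex.continuous_re
    filter_upwards [hopen.mem_nhds (by simp : (1 : ℂ) ∈ {β : ℂ | 0 < β.re})] with β hβ
    obtain ⟨hi, hv⟩ := hleb β hβ
    rw [← integral_rayIntegrand_eq_segmentFinitePart hΦ hR0 hR.2 hβ hθ, ← hv,
      ← MeasureTheory.setIntegral_union (Set.Ioc_disjoint_Ioi le_rfl) measurableSet_Ioi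
        (hi.mono_set Set.Ioc_subset_Ioi_self) (htailint β), Set.Ioc_union_Ioi_eq_Ioi hR0.le]

/-! ### Gamma factors and the connection formulas -/

/-- The parabolic cylinder function `V(a, z)`, defined by its initial values at `0`. As for `U`, the
coefficients are `0` where they have a pole of `Γ` in the denominator. -/
noncomputable def parabolicV (a z : ℂ) : ℂ :=
  (Real.pi : ℂ) * (2 : ℂ) ^ (a / 2 + 1 / 4) /
      (Complex.Gamma (3 / 4 - a / 2) ^ 2 * Complex.Gamma (1 / 4 + a / 2)) * weberEven a z +
    (Real.pi : ℂ) * (2 : ℂ) ^ (a / 2 + 3 / 4) /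
      (Complex.Gamma (1 / 4 - a / 2) ^ 2 * Complex.Gamma (3 / 4 + a / 2)) * weberOdd a z

theorem differentiable_parabolicV : Differentiable ℂ (fun q : ℂ × ℂ => parabolicV q.1 q.2) := by
  have h1 : Differentiable ℂ (fun q : ℂ × ℂ => (Complex.Gamma (3 / 4 + q.1 / 2))⁻¹) :=
    Differentiable.inv_Gamma (by fun_prop)
  have h2 : Differentiable ℂ (fun q : ℂ × ℂ => (Complex.Gamma (1 / 4 + q.1 / 2))⁻¹) :=
    Differentiable.inv_Gamma (by fun_prop)
  have h1' : Differentiable ℂ (fun q : ℂ × ℂ => (Complex.Gamma (3 / 4 - q.1 / 2))⁻¹) :=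
    Differentiable.inv_Gamma (by fun_prop)
  have h2' : Differentiable ℂ (fun q : ℂ × ℂ => (Complex.Gamma (1 / 4 - q.1 / 2))⁻¹) :=
    Differentiable.inv_Gamma (by fun_prop)
  have h3 : ∀ f : ℂ × ℂ → ℂ, Differentiable ℂ f → Differentiable ℂ (fun q => (2 : ℂ) ^ f q) :=
    fun f hf => hf.const_cpow (Or.inl two_ne_zero)
  have h4 := differentiable_weberEven
  have h5 := differentiable_weberOdd
  unfold parabolicV
  simp only [div_eq_mul_inv, mul_inv, ← inv_pow] at h1 h2 h1' h2' ⊢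
  exact (((h3 _ (by fun_prop)).const_mul _).mul ((h1'.pow 2).mul h2)).mul h4 |>.add
    ((((h3 _ (by fun_prop)).const_mul _).mul ((h2'.pow 2).mul h1)).mul h5)

theorem hasDerivAt_weber_combination (A B a z : ℂ) :
    HasDerivAt (fun z => A * weberEven a z + B * weberOdd a z)
      (A * weberEvenDeriv a z + B * weberOddDeriv a z) z :=
  ((hasDerivAt_weberEven a z).const_mul A).add ((hasDerivAt_weberOdd a z).const_mul B)

theorem deriv_weber_combination_zero (A B a : ℂ) :
    deriv (fun z => A * weberEven a z + B * weberOdd a z) 0 = B := by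
  rw [(hasDerivAt_weber_combination A B a 0).deriv, weberEvenDeriv_zero, weberOddDeriv_zero]
  ring

theorem deriv_deriv_weber_combination (A B a z : ℂ) :
    deriv (deriv (fun z => A * weberEven a z + B * weberOdd a z)) z -
      (z ^ 2 / 4 + a) * (A * weberEven a z + B * weberOdd a z) = 0 := by
  have h : deriv (fun z => A * weberEven a z + B * weberOdd a z) =
      fun z => A * weberEvenDeriv a z + B * weberOddDeriv a z :=
    funext fun z => (hasDerivAt_weber_combination A B a z).deriv
  have h2 : HasDerivAt (fun z => A * weberEvenDeriv a z + B * weberOddDeriv a z)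
      (A * ((z ^ 2 / 4 + a) * weberEven a z) + B * ((z ^ 2 / 4 + a) * weberOdd a z)) z :=
    ((hasDerivAt_weberEvenDeriv a z).const_mul A).add ((hasDerivAt_weberOddDeriv a z).const_mul B)
  rw [h, h2.deriv]
  ring

theorem ofReal_sqrt_pi_sq : (Real.sqrt Real.pi : ℂ) ^ 2 = Real.pi := by
  rw [← Complex.ofReal_pow, Real.sq_sqrt Real.pi_pos.le]

theorem ofReal_sqrt_pi_ne_zero : (Real.sqrt Real.pi : ℂ) ≠ 0 := by
  rw [Ne, Complex.ofReal_eq_zero, Real.sqrt_eq_zero']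
  exact not_le.2 Real.pi_pos

theorem ofReal_sqrt_two_sq : (Real.sqrt 2 : ℂ) ^ 2 = 2 := by
  rw [← Complex.ofReal_pow, Real.sq_sqrt (by norm_num)]
  norm_num

theorem ofReal_sqrt_two_ne_zero : (Real.sqrt 2 : ℂ) ≠ 0 := fun h => by
  simpa [h] using ofReal_sqrt_two_sq

theorem two_cpow_half : (2 : ℂ) ^ (1 / 2 : ℂ) = (Real.sqrt 2 : ℂ) := by
  rw [Real.sqrt_eq_rpow, Complex.ofReal_cpow (by norm_num)]
  push_cast
  rfl

theorem two_cpow_sub_half (a : ℂ) :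
    (2 : ℂ) ^ (a / 2 - 1 / 4) = (2 : ℂ) ^ (a / 2 + 1 / 4) / (Real.sqrt 2 : ℂ) := by
  rw [show a / 2 - 1 / 4 = (a / 2 + 1 / 4) - 1 / 2 by ring, Complex.cpow_sub _ _ two_ne_zero,
    two_cpow_half]

theorem two_cpow_add_half (a : ℂ) :
    (2 : ℂ) ^ (a / 2 + 3 / 4) = (2 : ℂ) ^ (a / 2 + 1 / 4) * (Real.sqrt 2 : ℂ) := by
  rw [show a / 2 + 3 / 4 = (a / 2 + 1 / 4) + 1 / 2 by ring, Complex.cpow_add _ _ two_ne_zero,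
    two_cpow_half]

theorem two_cpow_ne_zero (b : ℂ) : (2 : ℂ) ^ b ≠ 0 := by simp [Complex.cpow_eq_zero_iff]

/-- The reflection formula in a form that is valid at the poles as well. -/
theorem inv_Gamma_mul_inv_Gamma_one_sub (s : ℂ) :
    (Complex.Gamma s)⁻¹ * (Complex.Gamma (1 - s))⁻¹ * Real.pi = Complex.sin (Real.pi * s) := by
  have hpi : (Real.pi : ℂ) ≠ 0 := by exact_mod_cast Real.pi_ne_zero
  rw [← mul_inv, Complex.Gamma_mul_Gamma_one_sub, inv_div, div_mul_cancel₀ _ hpi]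

theorem inv_Gamma_one_quarter_mul (a : ℂ) :
    (Complex.Gamma (1 / 4 + a / 2))⁻¹ * (Complex.Gamma (3 / 4 - a / 2))⁻¹ *
      (Real.sqrt Real.pi : ℂ) ^ 2 = Complex.sin (Real.pi * (1 / 4 + a / 2)) := by
  rw [ofReal_sqrt_pi_sq, ← inv_Gamma_mul_inv_Gamma_one_sub,
    show 1 - (1 / 4 + a / 2) = 3 / 4 - a / 2 by ring]

theorem inv_Gamma_three_quarters_mul (a : ℂ) :
    (Complex.Gamma (3 / 4 + a / 2))⁻¹ * (Complex.Gamma (1 / 4 - a / 2))⁻¹ *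
      (Real.sqrt Real.pi : ℂ) ^ 2 = Complex.cos (Real.pi * (1 / 4 + a / 2)) := by
  rw [ofReal_sqrt_pi_sq, ← Complex.sin_pi_div_two_sub,
    show (Real.pi : ℂ) / 2 - Real.pi * (1 / 4 + a / 2) = Real.pi * (1 / 4 - a / 2) by ring,
    ← inv_Gamma_mul_inv_Gamma_one_sub, show 1 - (1 / 4 - a / 2) = 3 / 4 + a / 2 by ring]
  ring

/-- `sin πa` in terms of the angle `π (1/4 + a/2)` that the reflection formulas involve. -/
theorem sin_pi_mul (a : ℂ) : Complex.sin (Real.pi * a) =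
    Complex.sin (Real.pi * (1 / 4 + a / 2)) ^ 2 - Complex.cos (Real.pi * (1 / 4 + a / 2)) ^ 2 := by
  have h := Complex.cos_two_mul' (Real.pi * (1 / 4 + a / 2))
  rw [show 2 * ((Real.pi : ℂ) * (1 / 4 + a / 2)) = Real.pi * a + Real.pi / 2 by ring,
    Complex.cos_add_pi_div_two] at h
  linear_combination -h

theorem cos_pi_mul (a : ℂ) : Complex.cos (Real.pi * a) =
    2 * Complex.sin (Real.pi * (1 / 4 + a / 2)) * Complex.cos (Real.pi * (1 / 4 + a / 2)) := by
  have h := Complex.sin_two_mul (Real.pi * (1 / 4 + a / 2))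
  rw [show 2 * ((Real.pi : ℂ) * (1 / 4 + a / 2)) = Real.pi * a + Real.pi / 2 by ring,
    Complex.sin_add_pi_div_two] at h
  exact h

/-- The duplication formula in a form that is valid at the poles as well. -/
theorem inv_Gamma_half_add (a : ℂ) :
    (Complex.Gamma (1 / 2 + a))⁻¹ = 2 * (Real.sqrt Real.pi : ℂ) *
      (Complex.Gamma (1 / 4 + a / 2))⁻¹ * (Complex.Gamma (3 / 4 + a / 2))⁻¹ *
        ((2 : ℂ) ^ (a / 2 + 1 / 4))⁻¹ ^ 2 := by
  have h := congrArg Inv.inv (Complex.Gamma_mul_Gamma_add_half (1 / 4 + a / 2))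
  rw [show 1 / 4 + a / 2 + 1 / 2 = 3 / 4 + a / 2 by ring,
    show 2 * (1 / 4 + a / 2) = 1 / 2 + a by ring, mul_inv, mul_inv, mul_inv] at h
  have h2 : (2 : ℂ) ^ (1 - (1 / 2 + a)) = 2 * ((2 : ℂ) ^ (a / 2 + 1 / 4))⁻¹ ^ 2 := by
    rw [show 1 - (1 / 2 + a) = 1 + -((2 : ℕ) * (a / 2 + 1 / 4)) by push_cast; ring,
      Complex.cpow_add _ _ two_ne_zero, Complex.cpow_one, Complex.cpow_neg, Complex.cpow_nat_mul,
      inv_pow]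
  have hs := ofReal_sqrt_pi_ne_zero
  have h3 := two_cpow_ne_zero (1 - (1 / 2 + a))
  have h4 : (Complex.Gamma (1 / 2 + a))⁻¹ = (2 : ℂ) ^ (1 - (1 / 2 + a)) * (Real.sqrt Real.pi : ℂ) *
      ((Complex.Gamma (1 / 2 + a))⁻¹ * ((2 : ℂ) ^ (1 - (1 / 2 + a)))⁻¹ *
        (Real.sqrt Real.pi : ℂ)⁻¹) := by
    field_simp
  rw [h4, ← h, h2]
  ring

theorem inv_Gamma_half_sub (a : ℂ) :
    (Complex.Gamma (1 / 2 - a))⁻¹ = (Real.sqrt Real.pi : ℂ) *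
      (Complex.Gamma (1 / 4 - a / 2))⁻¹ * (Complex.Gamma (3 / 4 - a / 2))⁻¹ *
        ((2 : ℂ) ^ (a / 2 + 1 / 4)) ^ 2 := by
  have h := inv_Gamma_half_add (-a)
  rw [show 1 / 2 + -a = 1 / 2 - a by ring, show 1 / 4 + -a / 2 = 1 / 4 - a / 2 by ring,
    show 3 / 4 + -a / 2 = 3 / 4 - a / 2 by ring] at h
  have h2 : ((2 : ℂ) ^ (-a / 2 + 1 / 4))⁻¹ ^ 2 = ((2 : ℂ) ^ (a / 2 + 1 / 4)) ^ 2 / 2 := by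
    rw [← Complex.cpow_neg, show -(-a / 2 + 1 / 4) = a / 2 - 1 / 4 by ring, two_cpow_sub_half,
      div_pow, ofReal_sqrt_two_sq]
  rw [h, h2]
  ring

/-- `U` written with the entire function `1 / Γ` and a single power of `2`. -/
theorem parabolicU_eq (a z : ℂ) : parabolicU a z =
    (Real.sqrt Real.pi : ℂ) * (Complex.Gamma (3 / 4 + a / 2))⁻¹ * ((2 : ℂ) ^ (a / 2 + 1 / 4))⁻¹ *
        weberEven a z -
      (Real.sqrt Real.pi : ℂ) * (Real.sqrt 2 : ℂ) * (Complex.Gamma (1 / 4 + a / 2))⁻¹ *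
        ((2 : ℂ) ^ (a / 2 + 1 / 4))⁻¹ * weberOdd a z := by
  rw [parabolicU, two_cpow_sub_half]
  simp only [div_eq_mul_inv, mul_inv, inv_inv]
  ring

/-- `V` written with the entire function `1 / Γ` and a single power of `2`. -/
theorem parabolicV_eq (a z : ℂ) : parabolicV a z =
    (Real.sqrt Real.pi : ℂ) ^ 2 * (2 : ℂ) ^ (a / 2 + 1 / 4) *
        (Complex.Gamma (3 / 4 - a / 2))⁻¹ ^ 2 * (Complex.Gamma (1 / 4 + a / 2))⁻¹ *
        weberEven a z +
      (Real.sqrt Real.pi : ℂ) ^ 2 * (2 : ℂ) ^ (a / 2 + 1 / 4) * (Real.sqrt 2 : ℂ) *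
        (Complex.Gamma (1 / 4 - a / 2))⁻¹ ^ 2 * (Complex.Gamma (3 / 4 + a / 2))⁻¹ *
        weberOdd a z := by
  rw [parabolicV, two_cpow_add_half, ofReal_sqrt_pi_sq]
  simp only [div_eq_mul_inv, mul_inv, inv_pow]
  ring

theorem parabolicU_neg (a z : ℂ) :
    parabolicU a (-z) = -Complex.sin (Real.pi * a) * parabolicU a z +
      (Real.pi : ℂ) / Complex.Gamma (1 / 2 + a) * parabolicV a z := by
  have hS := inv_Gamma_one_quarter_mul a
  have hC := inv_Gamma_three_quarters_mul a
  have hSC := Complex.sin_sq_add_cos_sq (Real.pi * (1 / 4 + a / 2))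
  have hQ := inv_mul_cancel₀ (two_cpow_ne_zero (a / 2 + 1 / 4))
  rw [parabolicU_eq, parabolicU_eq, parabolicV_eq, weberEven_neg, weberOdd_neg,
    div_eq_mul_inv (Real.pi : ℂ), inv_Gamma_half_add, sin_pi_mul]
  rw [← hS, ← hC] at hSC ⊢
  rw [← ofReal_sqrt_pi_sq]
  generalize (Real.sqrt Real.pi : ℂ) = s at *
  generalize (Real.sqrt 2 : ℂ) = d at *
  generalize ((2 : ℂ) ^ (a / 2 + 1 / 4))⁻¹ = P at *
  generalize (2 : ℂ) ^ (a / 2 + 1 / 4) = Q at *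
  generalize (Complex.Gamma (1 / 4 + a / 2))⁻¹ = g1 at *
  generalize (Complex.Gamma (3 / 4 + a / 2))⁻¹ = g3 at *
  generalize (Complex.Gamma (1 / 4 - a / 2))⁻¹ = h1 at *
  generalize (Complex.Gamma (3 / 4 - a / 2))⁻¹ = h3 at *
  linear_combination (-s * P * (g3 * weberEven a z + d * g1 * weberOdd a z)) * hSC -
    (2 * s ^ 5 * g1 * g3 * P * (h3 ^ 2 * g1 * weberEven a z + d * h1 ^ 2 * g3 * weberOdd a z)) * hQ

theorem parabolicV_neg (a z : ℂ) :
    parabolicV a (-z) = Complex.cos (Real.pi * a) / Complex.Gamma (1 / 2 - a) * parabolicU a z +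
      Complex.sin (Real.pi * a) * parabolicV a z := by
  have hS := inv_Gamma_one_quarter_mul a
  have hC := inv_Gamma_three_quarters_mul a
  have hSC := Complex.sin_sq_add_cos_sq (Real.pi * (1 / 4 + a / 2))
  have hQ := inv_mul_cancel₀ (two_cpow_ne_zero (a / 2 + 1 / 4))
  rw [parabolicU_eq, parabolicV_eq, parabolicV_eq, weberEven_neg, weberOdd_neg,
    div_eq_mul_inv (Complex.cos _), inv_Gamma_half_sub, sin_pi_mul, cos_pi_mul]
  rw [← hS, ← hC] at hSC ⊢
  generalize (Real.sqrt Real.pi : ℂ) = s at *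
  generalize (Real.sqrt 2 : ℂ) = d at *
  generalize ((2 : ℂ) ^ (a / 2 + 1 / 4))⁻¹ = P at *
  generalize (2 : ℂ) ^ (a / 2 + 1 / 4) = Q at *
  generalize (Complex.Gamma (1 / 4 + a / 2))⁻¹ = g1 at *
  generalize (Complex.Gamma (3 / 4 + a / 2))⁻¹ = g3 at *
  generalize (Complex.Gamma (1 / 4 - a / 2))⁻¹ = h1 at *
  generalize (Complex.Gamma (3 / 4 - a / 2))⁻¹ = h3 at *
  linear_combination (-s ^ 2 * Q * (h3 ^ 2 * g1 * weberEven a z -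
      d * h1 ^ 2 * g3 * weberOdd a z)) * hSC -
    (2 * s ^ 6 * g1 * g3 * h1 ^ 2 * h3 ^ 2 * Q * (g3 * weberEven a z - d * g1 * weberOdd a z)) * hQ

theorem linearIndependent_parabolicU_parabolicV (a : ℂ) :
    LinearIndependent ℂ ![parabolicU a, parabolicV a] := by
  have hS := inv_Gamma_one_quarter_mul a
  have hC := inv_Gamma_three_quarters_mul a
  have hSC := Complex.sin_sq_add_cos_sq (Real.pi * (1 / 4 + a / 2))
  have hQ := inv_mul_cancel₀ (two_cpow_ne_zero (a / 2 + 1 / 4))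
  have hs := ofReal_sqrt_pi_ne_zero
  have hd := ofReal_sqrt_two_ne_zero
  rw [← hS, ← hC] at hSC
  rw [LinearIndependent.pair_iff]
  intro x y hxy
  have h0 := congrFun hxy 0
  have h1 := congrArg (fun f => deriv f 0) hxy
  have hcomb : x • parabolicU a + y • parabolicV a = fun z =>
      (x * ((Real.sqrt Real.pi : ℂ) * (Complex.Gamma (3 / 4 + a / 2))⁻¹ *
        ((2 : ℂ) ^ (a / 2 + 1 / 4))⁻¹) +
      y * ((Real.sqrt Real.pi : ℂ) ^ 2 * (2 : ℂ) ^ (a / 2 + 1 / 4) *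
        (Complex.Gamma (3 / 4 - a / 2))⁻¹ ^ 2 * (Complex.Gamma (1 / 4 + a / 2))⁻¹)) *
          weberEven a z +
      (-x * ((Real.sqrt Real.pi : ℂ) * (Real.sqrt 2 : ℂ) * (Complex.Gamma (1 / 4 + a / 2))⁻¹ *
        ((2 : ℂ) ^ (a / 2 + 1 / 4))⁻¹) +
      y * ((Real.sqrt Real.pi : ℂ) ^ 2 * (2 : ℂ) ^ (a / 2 + 1 / 4) * (Real.sqrt 2 : ℂ) *
        (Complex.Gamma (1 / 4 - a / 2))⁻¹ ^ 2 * (Complex.Gamma (3 / 4 + a / 2))⁻¹)) *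
          weberOdd a z := by
    funext z
    rw [Pi.add_apply, Pi.smul_apply, Pi.smul_apply, parabolicU_eq, parabolicV_eq, smul_eq_mul,
      smul_eq_mul]
    ring
  rw [hcomb] at h0 h1
  simp only [deriv_weber_combination_zero, weberEven_zero, weberOdd_zero, mul_one, mul_zero,
    add_zero, Pi.zero_apply] at h0 h1
  rw [show deriv (0 : ℂ → ℂ) 0 = 0 from congrFun (deriv_const' (0 : ℂ)) 0] at h1
  clear hcomb hxy hS hC
  generalize (Real.sqrt Real.pi : ℂ) = s at *
  generalize (Real.sqrt 2 : ℂ) = d at *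
  generalize ((2 : ℂ) ^ (a / 2 + 1 / 4))⁻¹ = P at *
  generalize (2 : ℂ) ^ (a / 2 + 1 / 4) = Q at *
  generalize (Complex.Gamma (1 / 4 + a / 2))⁻¹ = g1 at *
  generalize (Complex.Gamma (3 / 4 + a / 2))⁻¹ = g3 at *
  generalize (Complex.Gamma (1 / 4 - a / 2))⁻¹ = h1' at *
  generalize (Complex.Gamma (3 / 4 - a / 2))⁻¹ = h3 at *
  -- `d / s` is the Wronskian of the two functions
  have hx : d * x = 0 := by
    linear_combination s * (s ^ 2 * Q * d * h1' ^ 2 * g3) * h0 -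
      s * (s ^ 2 * Q * h3 ^ 2 * g1) * h1 - x * d * P * Q * hSC - x * d * hQ
  have hy : d * y = 0 := by
    linear_combination s * (s * g3 * P) * h1 + s * (s * d * g1 * P) * h0 -
      y * d * P * Q * hSC - y * d * hQ
  exact ⟨(mul_eq_zero.1 hx).resolve_left hd, (mul_eq_zero.1 hy).resolve_left hd⟩

/-- `V` is, up to a factor, the average of the two rotations of `U(-a, ·)` by a right angle. -/
theorem parabolicV_eq_average (a z : ℂ) :
    (Real.sqrt Real.pi : ℂ) * parabolicV a z = (Real.sqrt 2 : ℂ) *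
      (1 / 2 * (Complex.exp (-(Real.pi * (1 / 4 - a / 2)) * Complex.I) *
          parabolicU (-a) (-(Complex.I * z))) +
        1 / 2 * (Complex.exp (Real.pi * (1 / 4 - a / 2) * Complex.I) *
          parabolicU (-a) (Complex.I * z))) := by
  have hS := inv_Gamma_one_quarter_mul a
  have hC := inv_Gamma_three_quarters_mul a
  have hcos : Complex.cos (Real.pi * (1 / 4 - a / 2)) = Complex.sin (Real.pi * (1 / 4 + a / 2)) := by
    rw [← Complex.cos_pi_div_two_sub]
    ring_nf
  have hsin : Complex.sin (Real.pi * (1 / 4 - a / 2)) = Complex.cos (Real.pi * (1 / 4 + a / 2)) := by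
    rw [← Complex.sin_pi_div_two_sub]
    ring_nf
  have h2 : ((2 : ℂ) ^ (-a / 2 + 1 / 4))⁻¹ * (Real.sqrt 2 : ℂ) = (2 : ℂ) ^ (a / 2 + 1 / 4) := by
    rw [← Complex.cpow_neg, show -(-a / 2 + 1 / 4) = a / 2 - 1 / 4 by ring, two_cpow_sub_half,
      div_mul_cancel₀ _ ofReal_sqrt_two_ne_zero]
  have hI := Complex.I_sq
  -- the Gamma factors become the sine and cosine of `π (1/4 + a/2)`
  rw [parabolicU_eq, parabolicU_eq, parabolicV_eq, weberEven_neg, weberOdd_neg, weberEven_neg_I_mul,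
    weberOdd_neg_I_mul, Complex.exp_mul_I, Complex.exp_mul_I, Complex.cos_neg, Complex.sin_neg,
    hcos, hsin, ← hS, ← hC, ← h2, show 3 / 4 + -a / 2 = 3 / 4 - a / 2 by ring,
    show 1 / 4 + -a / 2 = 1 / 4 - a / 2 by ring]
  generalize (Real.sqrt Real.pi : ℂ) = s at *
  generalize (Real.sqrt 2 : ℂ) = d at *
  generalize ((2 : ℂ) ^ (-a / 2 + 1 / 4))⁻¹ = P at *
  generalize (Complex.Gamma (1 / 4 + a / 2))⁻¹ = g1 at *
  generalize (Complex.Gamma (3 / 4 + a / 2))⁻¹ = g3 at *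
  generalize (Complex.Gamma (1 / 4 - a / 2))⁻¹ = h1 at *
  generalize (Complex.Gamma (3 / 4 - a / 2))⁻¹ = h3 at *
  linear_combination (s ^ 3 * d ^ 2 * P * h1 ^ 2 * g3 * weberOdd a z) * hI

/-! ### The Laplace type representations -/

theorem sq_cpow_half {z : ℂ} (hz : 0 < z.re) : (z ^ 2) ^ (1 / 2 : ℂ) = z := by
  rw [one_div]
  exact Complex.sq_cpow_two_inv hz

theorem cpow_half_sq (y : ℂ) : (y ^ (1 / 2 : ℂ)) ^ 2 = y := by
  rw [← Complex.cpow_nat_mul]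
  norm_num

theorem re_cpow_half_pos {y : ℂ} (hy : 0 < y.re) : 0 < (y ^ (1 / 2 : ℂ)).re := by
  have hy0 : y ≠ 0 := fun h => by simp [h] at hy
  have harg := Complex.abs_arg_lt_pi_div_two_iff.2 (Or.inl hy)
  rw [Complex.cpow_def_of_ne_zero hy0, Complex.exp_re]
  refine mul_pos (Real.exp_pos _) (Real.cos_pos_of_mem_Ioo ?_)
  have him : (Complex.log y * (1 / 2)).im = y.arg / 2 := by
    rw [show Complex.log y * (1 / 2) = ((1 / 2 : ℝ) : ℂ) * Complex.log y by push_cast; ring,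
      Complex.im_ofReal_mul, Complex.log_im]
    ring
  rw [him]
  obtain ⟨h1, h2⟩ := abs_lt.1 harg
  have := Real.pi_pos
  constructor <;> linarith

/-- The ray values in terms of `z = √y`. Here `ε = 2 e^{-iψ}`, and the argument of `U` is turned by
the angle `ψ / 2`: `ψ = 0` gives the representation of `U`, and `ψ = ±π` gives the two lateral
integrals in the representation of `V`. -/
theorem hasRayValue_parabolicU_rotated {θ ψ : ℝ} (hθ : θ ∈ Set.Ioo (-Real.pi) Real.pi)
    (hτ : θ - ψ ∈ Set.Ioo (-Real.pi) Real.pi) {ε y z : ℂ} (hy : y = z ^ 2)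
    (hε : ε = 2 * Complex.exp (-ψ * Complex.I))
    (hc : ε * Complex.exp (θ * Complex.I) ∈ Complex.slitPlane)
    (hY : 0 < (Complex.exp (θ * Complex.I) * y).re)
    (hz : 0 < (Complex.exp (θ / 2 * Complex.I) * z).re)
    {α : ℂ} (hα : ∀ n : ℕ, α ≠ -(n : ℂ)) :
    HasRayValue θ α (fun p => Complex.exp (-(p * y)) * (1 + ε * p) ^ (-α - 1 / 2))
      (Complex.Gamma α * (Complex.exp (ψ * α * Complex.I) *
        Complex.exp (Complex.exp (ψ * Complex.I) * y / 4) *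
          parabolicU (2 * α - 1 / 2) (Complex.exp (ψ / 2 * Complex.I) * z))) := by
  have hceq : ε * Complex.exp (θ * Complex.I) =
      ((2 : ℝ) : ℂ) * Complex.exp (((θ - ψ : ℝ) : ℂ) * Complex.I) := by
    rw [hε, mul_assoc, ← Complex.exp_add]
    push_cast
    ring_nf
  have hnorm : ‖ε‖ ≤ 2 := by
    rw [hε, norm_mul, ← Complex.ofReal_neg, Complex.norm_exp_ofReal_mul_I]
    simp
  have hY2 : (Complex.exp (θ * Complex.I) * y) ^ (1 / 2 : ℂ) = Complex.exp (θ / 2 * Complex.I) * z := by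
    rw [← sq_cpow_half hz, mul_pow, ← Complex.exp_nat_mul, hy]
    congr 3
    push_cast
    ring
  have hζ : Complex.exp (ψ / 2 * Complex.I) * z = (Real.sqrt 2 : ℂ) *
      (Complex.exp (θ * Complex.I) * y) ^ (1 / 2 : ℂ) *
      (ε * Complex.exp (θ * Complex.I)) ^ (-(1 / 2) : ℂ) := by
    have h2 : ((2 : ℝ) : ℂ) ^ (-(1 / 2) : ℂ) * (Real.sqrt 2 : ℂ) = 1 := by
      rw [← two_cpow_half, Complex.cpow_neg]
      push_cast
      exact inv_mul_cancel₀ (two_cpow_ne_zero _)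
    have he : Complex.exp (ψ / 2 * Complex.I) = Complex.exp (θ / 2 * Complex.I) *
        Complex.exp (((θ - ψ : ℝ) : ℂ) * Complex.I * (-(1 / 2))) := by
      rw [← Complex.exp_add]
      push_cast
      ring_nf
    rw [hY2, hceq, ray_cpow hτ two_pos, he]
    linear_combination (-Complex.exp (θ / 2 * Complex.I) *
      Complex.exp (((θ - ψ : ℝ) : ℂ) * Complex.I * (-(1 / 2))) * z) * h2
  have key := hasRayValue_parabolicU hθ hnorm hc hY hζ hα
  convert! key using 1
  have h1 : Complex.exp (ψ * α * Complex.I) = Complex.exp (θ * Complex.I * α) *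
      Complex.exp (((θ - ψ : ℝ) : ℂ) * Complex.I * (-α)) := by
    rw [← Complex.exp_add]
    push_cast
    ring_nf
  have h2 : (Complex.exp (ψ / 2 * Complex.I) * z) ^ 2 = Complex.exp (ψ * Complex.I) * y := by
    rw [mul_pow, ← Complex.exp_nat_mul, hy]
    congr 2
    push_cast
    ring
  have h3 : (2 : ℂ) ^ α * ((2 : ℝ) : ℂ) ^ (-α) = 1 := by
    rw [Complex.cpow_neg]
    push_cast
    exact mul_inv_cancel₀ (two_cpow_ne_zero _)
  rw [h2, hceq, ray_cpow hτ two_pos, h1]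
  linear_combination (-Complex.Gamma α * Complex.exp (θ * Complex.I * α) *
    Complex.exp (((θ - ψ : ℝ) : ℂ) * Complex.I * (-α)) *
    Complex.exp (Complex.exp (ψ * Complex.I) * y / 4) *
    parabolicU (2 * α - 1 / 2) (Complex.exp (ψ / 2 * Complex.I) * z)) * h3

theorem isUMinusValue_parabolicU {a y : ℂ} (hy : 0 < y.re)
    (hα : ∀ n : ℕ, 1 / 4 + a / 2 ≠ -(n : ℂ)) :
    IsUMinusValue a y (parabolicU a (y ^ (1 / 2 : ℂ))) := by
  have h := hasRayValue_parabolicU_rotated (θ := 0) (ψ := 0) (ε := 2)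
    ⟨by linarith [Real.pi_pos], Real.pi_pos⟩ (by simp [Real.pi_pos]) (cpow_half_sq y).symm
    (by simp) (by simp) (by simpa using hy) (by simpa using re_cpow_half_pos hy) hα
  have hφ : (fun p => Complex.exp (-(p * y)) * (1 + 2 * p) ^ (-a / 2 - 3 / 4)) =
      fun p => Complex.exp (-(p * y)) * (1 + 2 * p) ^ (-(1 / 4 + a / 2) - 1 / 2) := by
    funext p
    rw [show -a / 2 - 3 / 4 = -(1 / 4 + a / 2) - 1 / 2 by ring]
  refine ⟨_, by rw [hφ]; exact h, ?_⟩
  · have hG := Complex.Gamma_ne_zero hα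
    have he : Complex.exp (-y / 4) * Complex.exp (y / 4) = 1 := by
      rw [← Complex.exp_add, show -y / 4 + y / 4 = 0 by ring, Complex.exp_zero]
    rw [show 2 * (1 / 4 + a / 2) - 1 / 2 = a by ring]
    simp only [Complex.ofReal_zero, zero_mul, zero_div, Complex.exp_zero, one_mul]
    generalize Complex.Gamma (1 / 4 + a / 2) = G at *
    generalize Complex.exp (-y / 4) = E1 at *
    generalize Complex.exp (y / 4) = E2 at *
    field_simp
    linear_combination (-parabolicU a (y ^ (1 / 2 : ℂ))) * he

theorem eventually_ray_conditions {y : ℂ} (hy : 0 < y.re) :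
    ∀ᶠ θ : ℝ in 𝓝 0, 0 < (Complex.exp (θ * Complex.I) * y).re ∧
      0 < (Complex.exp (θ / 2 * Complex.I) * y ^ (1 / 2 : ℂ)).re := by
  have h1 : Continuous fun θ : ℝ => (Complex.exp (θ * Complex.I) * y).re := by fun_prop
  have h2 : Continuous fun θ : ℝ => (Complex.exp (θ / 2 * Complex.I) * y ^ (1 / 2 : ℂ)).re := by
    fun_prop
  exact ((h1.tendsto 0).eventually (lt_mem_nhds (by simpa using hy))).and
    ((h2.tendsto 0).eventually (lt_mem_nhds (by simpa using re_cpow_half_pos hy)))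

theorem neg_two_mul_exp_mem_slitPlane {θ : ℝ} (h : Real.sin θ ≠ 0) :
    -2 * Complex.exp (θ * Complex.I) ∈ Complex.slitPlane := by
  right
  have : -2 * Complex.exp (θ * Complex.I) = ((-2 : ℝ) : ℂ) * Complex.exp (θ * Complex.I) := by
    push_cast
    ring
  rw [this, Complex.im_ofReal_mul, Complex.exp_ofReal_mul_I_im]
  exact mul_ne_zero (by norm_num) h

/-- The rays above the half-line carry `1 - 2p = 1 + 2 e^{-iπ} p` with `ψ = π`, those below it
`ψ = -π`; this is the choice for which `θ - ψ` stays between `-π` and `π`. -/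
theorem isUPlusValue_parabolicV {a y : ℂ} (hy : 0 < y.re)
    (hα : ∀ n : ℕ, 1 / 4 - a / 2 ≠ -(n : ℂ)) :
    IsUPlusValue a y (parabolicV a (y ^ (1 / 2 : ℂ)) / (Real.sqrt (2 / Real.pi) : ℂ)) := by
  set z := y ^ (1 / 2 : ℂ) with hz
  have hpi := Real.pi_pos
  have hφ : (fun p => Complex.exp (-(p * y)) * (1 - 2 * p) ^ (-3 / 4 + a / 2)) =
      fun p => Complex.exp (-(p * y)) * (1 + -2 * p) ^ (-(1 / 4 - a / 2) - 1 / 2) := by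
    funext p
    ring_nf
  have hIpos : Complex.exp (Real.pi / 2 * Complex.I) = Complex.I := Complex.exp_pi_div_two_mul_I
  have hIneg : Complex.exp (-Real.pi / 2 * Complex.I) = -Complex.I :=
    Complex.exp_neg_pi_div_two_mul_I
  have hEneg : Complex.exp (-Real.pi * Complex.I) = -1 := by
    rw [neg_mul, Complex.exp_neg, Complex.exp_pi_mul_I]
    norm_num
  refine ⟨_, ⟨Complex.Gamma (1 / 4 - a / 2) * (Complex.exp (Real.pi * (1 / 4 - a / 2) * Complex.I) *
      Complex.exp (-1 * y / 4) * parabolicU (-a) (Complex.I * z)),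
    Complex.Gamma (1 / 4 - a / 2) * (Complex.exp (-Real.pi * (1 / 4 - a / 2) * Complex.I) *
      Complex.exp (-1 * y / 4) * parabolicU (-a) (-Complex.I * z)), ?_, ?_, rfl⟩, ?_⟩
  · filter_upwards [nhdsWithin_le_nhds (eventually_ray_conditions hy), self_mem_nhdsWithin,
      nhdsWithin_le_nhds (Iio_mem_nhds hpi)] with θ hθ h0 h1
    have h0 : 0 < θ := h0
    have h1 : θ < Real.pi := h1
    have h := hasRayValue_parabolicU_rotated (θ := θ) (ψ := Real.pi) (ε := -2)
      ⟨by linarith, h1⟩ ⟨by linarith, by linarith⟩ (cpow_half_sq y).symm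
      (by rw [hEneg]; norm_num)
      (neg_two_mul_exp_mem_slitPlane (Real.sin_pos_of_pos_of_lt_pi h0 h1).ne') hθ.1 hθ.2 hα
    rw [hφ]
    rw [Complex.exp_pi_mul_I, hIpos, show 2 * (1 / 4 - a / 2) - 1 / 2 = -a by ring] at h
    exact h
  · filter_upwards [nhdsWithin_le_nhds (eventually_ray_conditions hy), self_mem_nhdsWithin,
      nhdsWithin_le_nhds (Ioi_mem_nhds (neg_lt_zero.2 hpi))] with θ hθ h0 h1
    have h0 : θ < 0 := h0
    have h1 : -Real.pi < θ := h1
    have h := hasRayValue_parabolicU_rotated (θ := θ) (ψ := -Real.pi) (ε := -2)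
      ⟨h1, by linarith⟩ ⟨by linarith, by linarith⟩ (cpow_half_sq y).symm
      (by push_cast; rw [neg_neg, Complex.exp_pi_mul_I]; norm_num)
      (neg_two_mul_exp_mem_slitPlane (Real.sin_neg_of_neg_of_neg_pi_lt h0 h1).ne) hθ.1 hθ.2 hα
    rw [hφ]
    rw [Complex.ofReal_neg, hEneg, hIneg, show 2 * (1 / 4 - a / 2) - 1 / 2 = -a by ring] at h
    exact h
  · have hG := Complex.Gamma_ne_zero hα
    have hs := ofReal_sqrt_pi_ne_zero
    have hd := ofReal_sqrt_two_ne_zero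
    have he : Complex.exp (y / 4) * Complex.exp (-1 * y / 4) = 1 := by
      rw [← Complex.exp_add, show y / 4 + -1 * y / 4 = 0 by ring, Complex.exp_zero]
    have hV := parabolicV_eq_average a z
    have hsq : (Real.sqrt (2 / Real.pi) : ℂ) = (Real.sqrt 2 : ℂ) / (Real.sqrt Real.pi : ℂ) := by
      rw [Real.sqrt_div (by norm_num)]
      push_cast
      rfl
    have hV' : parabolicV a z / (Real.sqrt (2 / Real.pi) : ℂ) =
        1 / 2 * (Complex.exp (-(Real.pi * (1 / 4 - a / 2)) * Complex.I) *
          parabolicU (-a) (-(Complex.I * z))) +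
        1 / 2 * (Complex.exp (Real.pi * (1 / 4 - a / 2) * Complex.I) *
          parabolicU (-a) (Complex.I * z)) := by
      rw [hsq, div_div_eq_mul_div, div_eq_iff hd, mul_comm, hV, mul_comm]
    rw [hV', neg_mul Complex.I z, ← neg_mul (Real.pi : ℂ)]
    generalize Complex.exp (-Real.pi * (1 / 4 - a / 2) * Complex.I) = e1
    generalize Complex.exp (Real.pi * (1 / 4 - a / 2) * Complex.I) = e2
    generalize parabolicU (-a) (-(Complex.I * z)) = u1
    generalize parabolicU (-a) (Complex.I * z) = u2
    generalize Complex.Gamma (1 / 4 - a / 2) = G at *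
    generalize Complex.exp (y / 4) = E1 at *
    generalize Complex.exp (-1 * y / 4) = E2 at *
    field_simp
    linear_combination (-(e1 * u1 + e2 * u2)) * he

theorem differentiable_uncurry_left {f : ℂ → ℂ → ℂ}
    (hf : Differentiable ℂ fun q : ℂ × ℂ => f q.1 q.2) (y : ℂ) : Differentiable ℂ fun a => f a y :=
  hf.comp (differentiable_id.prodMk (differentiable_const y))

theorem parabolicU_zero (a : ℂ) : parabolicU a 0 = (Real.sqrt Real.pi : ℂ) /
    ((2 : ℂ) ^ (a / 2 + 1 / 4) * Complex.Gamma (3 / 4 + a / 2)) := by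
  rw [parabolicU, weberEven_zero, weberOdd_zero]
  ring

theorem deriv_parabolicU_zero (a : ℂ) : deriv (parabolicU a) 0 = -(Real.sqrt Real.pi : ℂ) /
    ((2 : ℂ) ^ (a / 2 - 1 / 4) * Complex.Gamma (1 / 4 + a / 2)) := by
  rw [show parabolicU a = fun z => parabolicU a z from rfl]
  simp only [parabolicU]
  rw [deriv_weber_combination_zero]

theorem deriv_deriv_parabolicU (a z : ℂ) :
    deriv (deriv (parabolicU a)) z - (z ^ 2 / 4 + a) * parabolicU a z = 0 := by
  rw [show parabolicU a = fun z => parabolicU a z from rfl]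
  simp only [parabolicU]
  rw [deriv_deriv_weber_combination]

theorem parabolicV_zero (a : ℂ) : parabolicV a 0 = (Real.pi : ℂ) * (2 : ℂ) ^ (a / 2 + 1 / 4) /
    (Complex.Gamma (3 / 4 - a / 2) ^ 2 * Complex.Gamma (1 / 4 + a / 2)) := by
  rw [parabolicV, weberEven_zero, weberOdd_zero]
  ring

theorem deriv_parabolicV_zero (a : ℂ) : deriv (parabolicV a) 0 = (Real.pi : ℂ) * (2 : ℂ) ^ (a / 2 + 3 / 4) /
    (Complex.Gamma (1 / 4 - a / 2) ^ 2 * Complex.Gamma (3 / 4 + a / 2)) := by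
  rw [show parabolicV a = fun z => parabolicV a z from rfl]
  simp only [parabolicV]
  rw [deriv_weber_combination_zero]

theorem deriv_deriv_parabolicV (a z : ℂ) :
    deriv (deriv (parabolicV a)) z - (z ^ 2 / 4 + a) * parabolicV a z = 0 := by
  rw [show parabolicV a = fun z => parabolicV a z from rfl]
  simp only [parabolicV]
  rw [deriv_deriv_weber_combination]

theorem theorem1 :
    ∃ U V uMinus uPlus : ℂ → ℂ → ℂ,
      -- entire in `(a, z)`
      Differentiable ℂ (fun q : ℂ × ℂ => U q.1 q.2) ∧
      Differentiable ℂ (fun q : ℂ × ℂ => V q.1 q.2) ∧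
      -- linearly independent solutions of the Weber equation
      (∀ a z : ℂ, deriv (deriv (U a)) z - (z ^ 2 / 4 + a) * U a z = 0) ∧
      (∀ a z : ℂ, deriv (deriv (V a)) z - (z ^ 2 / 4 + a) * V a z = 0) ∧
      (∀ a : ℂ, LinearIndependent ℂ ![U a, V a]) ∧
      -- `U` and `V` are the classical parabolic cylinder functions
      (∀ a : ℂ,
        U a 0 = (Real.sqrt Real.pi : ℂ) /
          ((2 : ℂ) ^ (a / 2 + 1 / 4) * Complex.Gamma (3 / 4 + a / 2)) ∧
        deriv (U a) 0 = -(Real.sqrt Real.pi : ℂ) /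
          ((2 : ℂ) ^ (a / 2 - 1 / 4) * Complex.Gamma (1 / 4 + a / 2)) ∧
        V a 0 = (Real.pi : ℂ) * (2 : ℂ) ^ (a / 2 + 1 / 4) /
          (Complex.Gamma (3 / 4 - a / 2) ^ 2 * Complex.Gamma (1 / 4 + a / 2)) ∧
        deriv (V a) 0 = (Real.pi : ℂ) * (2 : ℂ) ^ (a / 2 + 3 / 4) /
          (Complex.Gamma (1 / 4 - a / 2) ^ 2 * Complex.Gamma (3 / 4 + a / 2))) ∧
      -- the representations, for `|arg z| < π / 4`
      (∀ a z : ℂ, 0 < z.re → 0 < (z ^ 2).re →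
        U a z = uMinus a (z ^ 2) ∧
        V a z = (Real.sqrt (2 / Real.pi) : ℂ) * uPlus a (z ^ 2)) ∧
      -- `uMinus` and `uPlus` are given by the Laplace type integrals away from the poles
      (∀ a y : ℂ, 0 < y.re → (∀ n : ℕ, 1 / 4 + a / 2 ≠ -(n : ℂ)) →
        IsUMinusValue a y (uMinus a y)) ∧
      (∀ a y : ℂ, 0 < y.re → (∀ n : ℕ, 1 / 4 - a / 2 ≠ -(n : ℂ)) →
        IsUPlusValue a y (uPlus a y)) ∧
      -- the singularities in `a` of these formulas are removable
      (∀ y : ℂ, 0 < y.re → Differentiable ℂ (fun a => uMinus a y)) ∧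
      (∀ y : ℂ, 0 < y.re → Differentiable ℂ (fun a => uPlus a y)) ∧
      -- the connection formulas
      (∀ a z : ℂ,
        U a (-z) = -Complex.sin (Real.pi * a) * U a z +
          (Real.pi : ℂ) / Complex.Gamma (1 / 2 + a) * V a z ∧
        V a (-z) = Complex.cos (Real.pi * a) / Complex.Gamma (1 / 2 - a) * U a z +
          Complex.sin (Real.pi * a) * V a z) := by
  have hpi : (Real.sqrt (2 / Real.pi) : ℂ) ≠ 0 := by
    rw [Ne, Complex.ofReal_eq_zero, Real.sqrt_eq_zero', not_le]
    exact div_pos two_pos Real.pi_pos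
  refine ⟨parabolicU, parabolicV, fun a y => parabolicU a (y ^ (1 / 2 : ℂ)),
    fun a y => parabolicV a (y ^ (1 / 2 : ℂ)) / (Real.sqrt (2 / Real.pi) : ℂ),
    differentiable_parabolicU, differentiable_parabolicV, deriv_deriv_parabolicU,
    deriv_deriv_parabolicV, linearIndependent_parabolicU_parabolicV, ?_, ?_, ?_, ?_, ?_, ?_, ?_⟩
  · intro a
    exact ⟨parabolicU_zero a, deriv_parabolicU_zero a, parabolicV_zero a, deriv_parabolicV_zero a⟩
  · intro a z hz _
    simp only [sq_cpow_half hz]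
    exact ⟨trivial, (mul_div_cancel₀ _ hpi).symm⟩
  · intro a y hy h
    exact isUMinusValue_parabolicU hy h
  · intro a y hy h
    exact isUPlusValue_parabolicV hy h
  · intro y _
    exact differentiable_uncurry_left differentiable_parabolicU _
  · intro y _
    exact (differentiable_uncurry_left differentiable_parabolicV _).div_const _
  · intro a z
    exact ⟨parabolicU_neg a z, parabolicV_neg a z⟩
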